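/- Let $A=(a_{ij})_{i,j\in I}$ be an affine Cartan matrix, i.e. a generalized Cartan matrix ($a_{ii}=2$; $a_{ij}\le 0$ for $i\ne j$; $a_{ij}=0\iff a_{ji}=0$) of corank $1$, symmetrizable by a positive diagonal matrix so that the symmetrized restriction to every proper subset of $I$ is positive definite. Let $0\in I$ be a distinguished index. The affine Weyl group $W_{af}$ is generated by $s_i$ $(i\in I)$ subject to $s_i^2=1$ and $(s_is_j)^{m_{ij}}=1$ for $i\neq j$, where $m_{ij}=2,3,4,6$ if $a_{ij}a_{ji}=0,1,2,3$ (no relation between $s_i$ and $s_j$ if $a_{ij}a_{ji}=4$); $\ell$ is its length function. It acts on $X_{af}=\bigoplus_{i}\mathbb Z\alpha_i$ by $s_i\mu=\mu-\langle\alpha_i^\vee,\mu\rangle\alpha_i$, where $\langle\alpha_i^\vee,\alpha_j\rangle=a_{ij}$. Let $R_{af}=W_{af}\{\alpha_i\}$ be the set of (real) affine roots, $R_{af}^+$ the set of those with nonnegative coefficients, and $R_{af}^-=R_{af}\setminus R_{af}^+$. Let $V^*=\bigoplus_{i\ne 0}\mathbb R\alpha_i^\vee$. Each $\mu\in X_{af}$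 defines an affine function $\mu(v)=\langle v,\mu\rangle+\mu_0$ on $V^*$, where $\mu_0$ is the coefficient of $\alpha_0$ in $\mu$. (In the untwisted case, with null root $\delta=\alpha_0+\theta$ and $\theta$ the highest finite root, $\alpha+k\delta$ is the function $v\mapsto\langle v,\alpha\rangle+k$.) For $\beta\in R_{af}$ put $H_\beta=\{v\in V^*:\beta(v)=0\}$. Alcoves are the closures of the connected components of $V^*\setminus\bigcup_{\beta\in R_{af}} H_\beta$, and their panels are their codimension-one faces. The base alcove is $\mathbf a_0=\{v:\beta(v)\ge 0\ \text{for all}\ \beta\in R_{af}^+\}$ (in the untwisted case, $0\le\langle v,\alpha\rangle\le 1$ for all positive finite roots $\alpha$). The group $W_{af}$ acts on $V^*$ by affine transformations with $(u\mu)(uv)=\mu(v)$ for $u\in W_{af}$, $\mu\in X_{af}$, $v\in V^*$, and acts simply transitively on the alcoves. An alcove walk $\gamma=(\mathbf a_0,\mathbf a_1,\dots,\mathbf a_m)$ to $w\mathbf a_0$ is a sequence of alcoves starting at $\mathbf a_0$ with $\mathbf a_m=w\mathbf a_0$, in which successive alcoves are distinct and share a panel; it need not be of minimal length. If $\mathbf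 a_{j-1}=u\mathbf a_0$ and $\mathbf a_j=us_{i_j}\mathbf a_0$, then step $j$ has type $i_j$, and it is indexed by the affine root $\beta_j$ such that $H_{\beta_j}$ contains the common panel, and $\beta_j\in R_{af}^+$ if $\ell(u)<\ell(us_{i_j})$, $\beta_j\in R_{af}^-$ if $\ell(us_{i_j})<\ell(u)$. For a mask $\varepsilon\in\{0,1\}^m$ put $w^\varepsilon=s_{i_1}^{\varepsilon_1}\cdots s_{i_m}^{\varepsilon_m}$, let $|\varepsilon|$ be the number of $1$'s in $\varepsilon$, and let $$\Psi_\gamma^\varepsilon=\prod_{\varepsilon_j=1}\beta_j\in\mathbb Z[\alpha_i: i\in I].$$ Proposition. Let $w,v\in W_{af}$. For any two alcove walks $\gamma,\gamma'$ from $\mathbf a_0$ to $w\mathbf a_0$, $$\sum_{|\varepsilon|=\ell(v),\ w^{\varepsilon}=v}\Psi_\gamma^{\varepsilon}=\sum_{|\varepsilon'|=\ell(v),\ w^{\varepsilon'}=v}\Psi_{\gamma'}^{\varepsilon'},$$ where the sums run over masks for $\gamma$ and for $\gamma'$ respectively. Consequently there is a unique polynomial $\psi^v(w)\in\mathbb Z[\alpha_i:i\in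 I]$ that is equal to this sum for every alcove walk from $\mathbf a_0$ to $w\mathbf a_0$. -/

import Mathlib

/-- An affine Cartan datum: a generalized Cartan matrix `A` indexed by `I`, with a distinguished
index `zero`, of corank one and such that its restriction to every proper subset of `I` is positive
definite. As `A` need not be symmetric, positive definiteness refers to the symmetric matrix
`diag(d) * A` for a suitable positive vector `d`. -/
structure AffineCartanDatum (I : Type*) [Fintype I] [DecidableEq I] where
  /-- the Cartan matrix `(a_ij)` -/
  A : Matrix I I ℤ
  /-- the index `0` -/
  zero : I
  diag : ∀ i, A i i = 2
  nonpos : ∀ i j, i ≠ j → A i j ≤ 0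
  zero_iff : ∀ i j, A i j = 0 ↔ A j i = 0
  corank_one : (A.map (Int.cast : ℤ → ℝ)).rank + 1 = Fintype.card I
  posDef : ∃ d : I → ℝ, (∀ i, 0 < d i) ∧
    (Matrix.diagonal d * A.map (Int.cast : ℤ → ℝ)).IsSymm ∧
    ∀ J : Finset I, J ≠ Finset.univ →
      ((Matrix.diagonal d * A.map (Int.cast : ℤ → ℝ)).submatrix
        (Subtype.val : J → I) (Subtype.val : J → I)).PosDef

namespace AffineCartanDatum

variable {I : Type*} [Fintype I] [DecidableEq I]

/-- `m_ij` as a function of `a_ij * a_ji`: `0, 1, 2, 3` give `2, 3, 4, 6`. Otherwise (which happens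
only for `a_ij * a_ji = 4`, when `I` has two elements) there is no relation between `s_i` and `s_j`;
Mathlib encodes this by `0`. -/
def coxeterEntry (c : ℤ) : ℕ :=
  if c = 0 then 2 else if c = 1 then 3 else if c = 2 then 4 else if c = 3 then 6 else 0

/-- The Coxeter matrix `(m_ij)`. -/
def coxeterMatrix (D : AffineCartanDatum I) : CoxeterMatrix I where
  M := Matrix.of fun i j => if i = j then 1 else coxeterEntry (D.A i j * D.A j i)
  isSymm := by
    ext i j
    simp only [Matrix.transpose_apply, Matrix.of_apply, eq_comm (a := j) (b := i),
      mul_comm (D.A j i)]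
  diagonal := by simp
  off_diagonal := by
    intro i j h
    simp only [Matrix.of_apply, if_neg h, coxeterEntry]
    split_ifs <;> norm_num

/-- The affine Weyl group: generated by the `s_i`, subject to `s_i ^ 2 = 1`
and `(s_i s_j) ^ m_ij = 1`. -/
abbrev AffineWeylGroup (D : AffineCartanDatum I) : Type _ := D.coxeterMatrix.Group

/-- The generator `s_i`. -/
def s (D : AffineCartanDatum I) (i : I) : D.AffineWeylGroup := D.coxeterMatrix.simple i

/-- The length function on the affine Weyl group with respect to the generators `s_i`. -/
noncomputable def length (D : AffineCartanDatum I) (w : D.AffineWeylGroup) : ℕ :=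
  D.coxeterMatrix.toCoxeterSystem.length w

/-- The affine root lattice, in coordinates with respect to the simple affine roots. -/
abbrev RootLattice (_D : AffineCartanDatum I) : Type _ := I → ℤ

/-- The simple affine root `α_i`. -/
def simpleRoot (D : AffineCartanDatum I) (i : I) : D.RootLattice := Pi.single i 1

/-- The evaluation `μ ↦ ⟨α_i^∨, μ⟩` of the simple affine coroot, with `⟨α_i^∨, α_j⟩ = a_ij`. -/
def simpleCoroot (D : AffineCartanDatum I) (i : I) : D.RootLattice →ₗ[ℤ] ℤ :=
  (LinearMap.proj i).comp D.A.mulVecLin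

/-- The simple reflection `μ ↦ μ - ⟨α_i^∨, μ⟩ α_i` of the affine root lattice. -/
def simpleReflection (D : AffineCartanDatum I) (i : I) : Module.End ℤ D.RootLattice :=
  LinearMap.id - (D.simpleCoroot i).smulRight (D.simpleRoot i)

theorem simpleCoroot_simpleRoot (D : AffineCartanDatum I) (i j : I) :
    D.simpleCoroot i (D.simpleRoot j) = D.A i j := by
  simp [simpleCoroot, simpleRoot]

theorem simpleReflection_apply (D : AffineCartanDatum I) (i : I) (μ : D.RootLattice) :
    D.simpleReflection i μ = μ - D.simpleCoroot i μ • D.simpleRoot i := by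
  simp [simpleReflection]

theorem isLiftable_simpleReflection (D : AffineCartanDatum I) :
    D.coxeterMatrix.IsLiftable D.simpleReflection := by
  intro i j
  have hM : D.coxeterMatrix i j = if i = j then 1 else coxeterEntry (D.A i j * D.A j i) := rfl
  rw [hM]
  by_cases hij : i = j
  · subst hij
    refine LinearMap.ext fun μ => ?_
    have h2 := D.simpleCoroot_simpleRoot i i
    rw [D.diag] at h2
    simp only [if_true, pow_one, Module.End.mul_apply, Module.End.one_apply,
      simpleReflection_apply, map_sub, map_smul, h2]
    module
  · rw [if_neg hij]
    have ha := D.nonpos i j hij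
    have hb := D.nonpos j i (Ne.symm hij)
    have hz := D.zero_iff i j
    have ei := D.diag i
    have ej := D.diag j
    have hii := D.simpleCoroot_simpleRoot i i
    have hjj := D.simpleCoroot_simpleRoot j j
    have hab := D.simpleCoroot_simpleRoot i j
    have hba := D.simpleCoroot_simpleRoot j i
    generalize D.A i j = a at *
    generalize D.A j i = b at *
    rw [ei] at hii
    rw [ej] at hjj
    have key : (a = 0 ∧ b = 0) ∨ (a = -1 ∧ b = -1) ∨ (a = -1 ∧ b = -2) ∨ (a = -2 ∧ b = -1) ∨
        (a = -1 ∧ b = -3) ∨ (a = -3 ∧ b = -1) ∨ coxeterEntry (a * b) = 0 := by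
      by_cases h0 : a = 0
      · exact Or.inl ⟨h0, hz.1 h0⟩
      have hb0 : b ≠ 0 := fun h => h0 (hz.2 h)
      by_cases h4 : 3 < a * b
      · have : coxeterEntry (a * b) = 0 := by
          simp only [coxeterEntry]
          split_ifs <;> omega
        simp [this]
      · have h1 : -3 ≤ a := by nlinarith [(show b ≤ -1 by omega)]
        have h2 : -3 ≤ b := by nlinarith [(show a ≤ -1 by omega)]
        interval_cases a <;> interval_cases b <;> simp_all
    have step : ∀ (μ : D.RootLattice) (x y : ℤ),
        (D.simpleReflection i * D.simpleReflection j)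
          (μ + x • D.simpleRoot i + y • D.simpleRoot j) =
        μ + (-x - D.simpleCoroot i μ - a * (-y - D.simpleCoroot j μ - b * x)) • D.simpleRoot i +
          (-y - D.simpleCoroot j μ - b * x) • D.simpleRoot j := by
      intro μ x y
      simp only [Module.End.mul_apply, simpleReflection_apply, map_add, map_sub, map_smul, hii,
        hjj, hab, hba]
      module
    have iter : ∀ (n : ℕ) (μ : D.RootLattice) (x y : ℤ),
        ((D.simpleReflection i * D.simpleReflection j) ^ (n + 1))
          (μ + x • D.simpleRoot i + y • D.simpleRoot j) =
        ((D.simpleReflection i * D.simpleReflection j) ^ n)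
          (μ + (-x - D.simpleCoroot i μ - a * (-y - D.simpleCoroot j μ - b * x)) •
            D.simpleRoot i + (-y - D.simpleCoroot j μ - b * x) • D.simpleRoot j) := by
      intro n μ x y
      rw [pow_succ, Module.End.mul_apply, step]
    have fin : ∀ n : ℕ, (∀ μ : D.RootLattice,
        ((D.simpleReflection i * D.simpleReflection j) ^ n)
          (μ + (0 : ℤ) • D.simpleRoot i + (0 : ℤ) • D.simpleRoot j) = μ) →
        (D.simpleReflection i * D.simpleReflection j) ^ n = 1 := by
      intro n h
      refine LinearMap.ext fun μ => ?_
      have := h μ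
      rwa [zero_smul, zero_smul, add_zero, add_zero] at this
    apply fin
    intro μ
    rcases key with ⟨rfl, rfl⟩ | ⟨rfl, rfl⟩ | ⟨rfl, rfl⟩ | ⟨rfl, rfl⟩ | ⟨rfl, rfl⟩ | ⟨rfl, rfl⟩ | h
    · rw [show coxeterEntry (0 * 0) = 2 from rfl]
      simp only [iter, pow_zero, Module.End.one_apply]
      module
    · rw [show coxeterEntry (-1 * -1) = 3 from rfl]
      simp only [iter, pow_zero, Module.End.one_apply]
      module
    · rw [show coxeterEntry (-1 * -2) = 4 from rfl]
      simp only [iter, pow_zero, Module.End.one_apply]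
      module
    · rw [show coxeterEntry (-2 * -1) = 4 from rfl]
      simp only [iter, pow_zero, Module.End.one_apply]
      module
    · rw [show coxeterEntry (-1 * -3) = 6 from rfl]
      simp only [iter, pow_zero, Module.End.one_apply]
      module
    · rw [show coxeterEntry (-3 * -1) = 6 from rfl]
      simp only [iter, pow_zero, Module.End.one_apply]
      module
    · rw [h, pow_zero, Module.End.one_apply]
      module

/-- The action of the affine Weyl group on the affine root lattice, determined by
`s_i μ = μ - ⟨α_i^∨, μ⟩ α_i`. -/
def action (D : AffineCartanDatum I) : D.AffineWeylGroup →* Module.End ℤ D.RootLattice :=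
  D.coxeterMatrix.toCoxeterSystem.lift ⟨D.simpleReflection, D.isLiftable_simpleReflection⟩

/-- The set of (real) affine roots `w α_i`. -/
def affineRoots (D : AffineCartanDatum I) : Set D.RootLattice :=
  {β | ∃ w i, β = D.action w (D.simpleRoot i)}

/-- The positive affine roots: those with nonnegative coordinates. -/
def positiveRoots (D : AffineCartanDatum I) : Set D.RootLattice :=
  {β | β ∈ D.affineRoots ∧ ∀ i, 0 ≤ β i}

/-- The negative affine roots. -/
def negativeRoots (D : AffineCartanDatum I) : Set D.RootLattice :=
  {β | β ∈ D.affineRoots ∧ β ∉ D.positiveRoots}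

/-- The space `V^*`, spanned over `ℝ` by the finite simple coroots `α_i^∨`, `i ≠ 0`, in coordinates
with respect to them. -/
abbrev V (D : AffineCartanDatum I) : Type _ := {i : I // i ≠ D.zero} → ℝ

/-- The pairing `⟨v, μ⟩` of `v ∈ V^*` with an element of the affine root lattice. It vanishes on
the null root `δ`, because `A δ = 0`. -/
def pairing (D : AffineCartanDatum I) (v : D.V) (μ : D.RootLattice) : ℝ :=
  ∑ i, v i * (D.simpleCoroot i.1 μ : ℝ)

/-- The affine function on `V^*` attached to `μ`: the pairing plus the coefficient of `α_0` in `μ`.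
If `δ = α_0 + θ` and `α` is in the span of the `α_i` with `i ≠ 0`, then `α + k δ` is the function
`v ↦ ⟨v, α⟩ + k`. -/
def affineValue (D : AffineCartanDatum I) (v : D.V) (μ : D.RootLattice) : ℝ :=
  D.pairing v μ + (μ D.zero : ℝ)

/-- The affine function attached to `α + k δ`, for `α` in the finite root lattice and `δ` a null
vector of `A` with `α_0`-coefficient one, is `v ↦ ⟨v, α⟩ + k`. -/
theorem affineValue_add_smul (D : AffineCartanDatum I) (α δ : D.RootLattice) (k : ℤ) (v : D.V)
    (hα : α D.zero = 0) (hδ : D.A.mulVec δ = 0) (hδ0 : δ D.zero = 1) :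
    D.affineValue v (α + k • δ) = D.pairing v α + k := by
  have h : ∀ i, D.simpleCoroot i δ = 0 := fun i => congrFun hδ i
  simp only [affineValue, pairing, map_add, map_smul, h, Pi.add_apply, Pi.smul_apply, hα,
    hδ0, smul_eq_mul, mul_zero, add_zero, mul_one, zero_add]

/-- The hyperplane `H_β` in `V^*`; for `β = α + k δ` it is `{v | ⟨v, α⟩ + k = 0}`. -/
def hyperplane (D : AffineCartanDatum I) (β : D.RootLattice) : Set D.V :=
  {v | D.affineValue v β = 0}

/-- The complement in `V^*` of all the hyperplanes. -/
def hyperplaneComplement (D : AffineCartanDatum I) : Set D.V :=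
  {v | ∀ β ∈ D.affineRoots, v ∉ D.hyperplane β}

/-- Alcoves: closures of the connected components of the complement of the hyperplanes. -/
def IsAlcove (D : AffineCartanDatum I) (a : Set D.V) : Prop :=
  ∃ v ∈ D.hyperplaneComplement, a = closure (connectedComponentIn D.hyperplaneComplement v)

/-- The base alcove, on which all positive affine roots are nonnegative. When the affine roots are
the `α + k δ` with `α` a finite root and `k ∈ ℤ`, it is given by `0 ≤ ⟨v, α⟩ ≤ 1` for all positive
finite roots `α`. -/
def baseAlcove (D : AffineCartanDatum I) : Set D.V :=
  {v | ∀ β ∈ D.positiveRoots, 0 ≤ D.affineValue v β}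

/-- The alcove `w a_0`. The point `v` is the image of `u` under `w` for the action of the affine
Weyl group on `V^*` by affine transformations precisely when `(w μ)(v) = μ(u)` for all `μ`. -/
def alcove (D : AffineCartanDatum I) (w : D.AffineWeylGroup) : Set D.V :=
  {v | ∃ u ∈ D.baseAlcove, ∀ μ, D.affineValue v (D.action w μ) = D.affineValue u μ}

/-- `F` is a panel (face of codimension one) of the alcove `a`: an intersection of `a` with one of
the hyperplanes that affinely spans this hyperplane. -/
def IsPanel (D : AffineCartanDatum I) (a F : Set D.V) : Prop :=
  ∃ β ∈ D.affineRoots, F = a ∩ D.hyperplane β ∧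
    (affineSpan ℝ F : Set D.V) = D.hyperplane β

/-- The element `w` of the affine Weyl group with `a = w a_0`. -/
noncomputable def element (D : AffineCartanDatum I) (a : Set D.V) : D.AffineWeylGroup :=
  Function.invFun D.alcove a

/-- The type of the panel between two adjacent alcoves: the index `i` such that they are `v a_0`
and `v s_i a_0` for some `v`. -/
noncomputable def stepType (D : AffineCartanDatum I) (a a' : Set D.V) : I :=
  @Classical.epsilon I ⟨D.zero⟩ fun i => ∃ v, a = D.alcove v ∧ a' = D.alcove (v * D.s i)

/-- The signed affine root indexing the crossing `a → a'`: of the two affine roots whose hyperplane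
contains the common panel, the positive one for a forward step and the negative one for a backward
step. -/
noncomputable def stepRoot (D : AffineCartanDatum I) (a a' : Set D.V) : D.RootLattice :=
  Classical.epsilon fun β => β ∈ D.affineRoots ∧
    (∃ F, D.IsPanel a F ∧ D.IsPanel a' F ∧ F ⊆ D.hyperplane β) ∧
    (D.length (D.element a) < D.length (D.element a') → β ∈ D.positiveRoots) ∧
    (D.length (D.element a') < D.length (D.element a) → β ∈ D.negativeRoots)

/-- An alcove walk `(a_0, a_1, …, a_m)` starting at the base alcove: a sequence of alcoves in which
successive ones are distinct and share a panel. -/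
structure AlcoveWalk (D : AffineCartanDatum I) where
  /-- the number of steps -/
  m : ℕ
  /-- the sequence of alcoves -/
  a : Fin (m + 1) → Set D.V
  isAlcove : ∀ j, D.IsAlcove (a j)
  start : a 0 = D.baseAlcove
  ne : ∀ j : Fin m, a j.castSucc ≠ a j.succ
  share_panel : ∀ j : Fin m, ∃ F, D.IsPanel (a j.castSucc) F ∧ D.IsPanel (a j.succ) F

namespace AlcoveWalk

variable {D : AffineCartanDatum I}

/-- The walk `γ` ends in the alcove `w a_0`. -/
def IsTo (γ : D.AlcoveWalk) (w : D.AffineWeylGroup) : Prop := γ.a (Fin.last γ.m) = D.alcove w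

/-- The `j`-th letter of the type of `γ`. -/
noncomputable def type (γ : D.AlcoveWalk) (j : Fin γ.m) : I :=
  D.stepType (γ.a j.castSucc) (γ.a j.succ)

/-- The signed affine root indexing the crossing of `γ` at step `j`. -/
noncomputable def root (γ : D.AlcoveWalk) (j : Fin γ.m) : D.RootLattice :=
  D.stepRoot (γ.a j.castSucc) (γ.a j.succ)

/-- Masks for `γ`: binary vectors with one entry for each step. -/
abbrev Mask (γ : D.AlcoveWalk) : Type := Fin γ.m → Bool

/-- The support `|ε|` of a mask: the number of its nonzero entries. -/
def support (γ : D.AlcoveWalk) (ε : γ.Mask) : ℕ :=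
  (Finset.univ.filter fun j => ε j = true).card

/-- The element `w^ε = s_{i_1}^{ε_1} ⋯ s_{i_m}^{ε_m}`, where `s_{i_1} ⋯ s_{i_m}` is the type
of `γ`. -/
noncomputable def subexpression (γ : D.AlcoveWalk) (ε : γ.Mask) : D.AffineWeylGroup :=
  (List.ofFn fun j => D.s (γ.type j) ^ (ε j).toNat).prod

end AlcoveWalk

/-- An element of the affine root lattice, as a linear form in the polynomial ring over `ℤ` in the
simple affine roots. -/
noncomputable def toPolynomial (D : AffineCartanDatum I) (β : D.RootLattice) : MvPolynomial I ℤ :=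
  ∑ i, MvPolynomial.C (β i) * MvPolynomial.X i

namespace AlcoveWalk

variable {D : AffineCartanDatum I}

/-- `Ψ_γ^ε`: the product of the signed affine roots indexing the crossings shown by `ε`. -/
noncomputable def Psi (γ : D.AlcoveWalk) (ε : γ.Mask) : MvPolynomial I ℤ :=
  ∏ j ∈ Finset.univ.filter (fun j => ε j = true), D.toPolynomial (γ.root j)

open Classical in
/-- The sum of `Ψ_γ^ε` over all masks `ε` with `|ε| = ℓ(v)` and `w^ε = v`. -/
noncomputable def maskSum (γ : D.AlcoveWalk) (v : D.AffineWeylGroup) : MvPolynomial I ℤ :=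
  ∑ ε : γ.Mask with γ.support ε = D.length v ∧ γ.subexpression ε = v, γ.Psi ε

end AlcoveWalk

end AffineCartanDatum

/-!
Let `u_0 = 1, u_1, …, u_m = w` be the group elements of an alcove walk, so that `u_j = u_{j-1} s_i`
for the type `i` of step `j`. By the choice of signs, step `j` is indexed by the root `u_{j-1} α_i`,
whether it is a forward or a backward step. The mask sums of the walk, for all `v` at once, are
therefore the coefficients of the element `Z = ∑ ψ^v e_v` of the free module over the polynomial
ring with basis `e_v` that is obtained from `e_1` by applying `1 + (u_{j-1} α_i) T_i` for the
successive steps, where `T_i` is right multiplication by a generator of the nilCoxeter algebra: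
`e_v ↦ e_{v s_i}` if this is longer, and `e_v ↦ 0` otherwise (`maskElement`, `nilOp`).

That `Z` depends on `w` only follows from a characterization of `Z` that does not mention the walk.
For every `χ` in the root lattice let `C_χ` be the Chevalley operator
`e_v ↦ (v χ) e_v - ∑ ⟨γ_t^∨, χ⟩ e_{v t}`, the sum running over the reflections `t` with
`ℓ(v t) = ℓ(v) - 1`. The relation `C_χ T_i = T_i C_{s_i χ} - ⟨α_i^∨, χ⟩` (`chevalley_nilOp`) shows,
step by step along the walk, that `C_χ Z = (w χ) Z` for all `χ` (`chevalley_maskElement`). The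
operators `C_χ` are triangular with diagonal entries `v χ`, and the group acts faithfully on the
lattice, so the common eigenvectors with eigenvalues `w χ` form a space of rank at most one. As the
coefficient of `Z` at `1` is `1`, this determines `Z` (`eq_of_chevalley_eq`). No braid relation has
to be checked.

The root combinatorics rests on the fact that `w α_i` is positive if and only if `w s_i` is longer
than `w` (`action_simpleRoot_nonneg`), proved by reduction to rank two. The geometric input is that
the alcoves are exactly the `w a_0`, for unique `w`, and that two distinct alcoves share a panel
only if they are `w a_0` and `w s_i a_0` (`isAlcove_iff`, `exists_eq_mul_s`). For this, the values
of the simple roots serve as coordinates on `V^*`. A null vector of the Cartan matrix has all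
entries of the same sign, and the roots are bounded modulo this vector, so that at each point only
finitely many positive roots are negative; hence the `w a_0` cover `V^*`.
-/

namespace AffineCartanDatum

variable {I : Type*} [Fintype I] [DecidableEq I] (D : AffineCartanDatum I)

/-! ### Positive and negative roots -/

/-- The Coxeter system of the affine Weyl group. -/
abbrev cs : CoxeterSystem D.coxeterMatrix D.AffineWeylGroup := D.coxeterMatrix.toCoxeterSystem

theorem cs_simple (i : I) : D.cs.simple i = D.s i := rfl

theorem s_mul_s (i : I) : D.s i * D.s i = 1 := D.cs.simple_mul_simple_self i

theorem length_eq (w : D.AffineWeylGroup) : D.length w = D.cs.length w := rfl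

theorem length_one : D.length 1 = 0 := D.cs.length_one

theorem length_mul_s (w : D.AffineWeylGroup) (i : I) :
    D.length (w * D.s i) = D.length w + 1 ∨ D.length (w * D.s i) + 1 = D.length w :=
  D.cs.length_mul_simple w i

theorem exists_descent {w : D.AffineWeylGroup} (hw : w ≠ 1) :
    ∃ i, D.length (w * D.s i) < D.length w := D.cs.exists_rightDescent_of_ne_one hw

theorem action_s (i : I) : D.action (D.s i) = D.simpleReflection i :=
  D.cs.lift_apply_simple D.isLiftable_simpleReflection i

theorem action_mul (u w : D.AffineWeylGroup) (μ : D.RootLattice) :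
    D.action (u * w) μ = D.action u (D.action w μ) := by
  rw [map_mul, Module.End.mul_apply]

theorem action_one (μ : D.RootLattice) : D.action 1 μ = μ := by
  rw [map_one, Module.End.one_apply]

theorem action_inv_action (u : D.AffineWeylGroup) (μ : D.RootLattice) :
    D.action u⁻¹ (D.action u μ) = μ := by
  rw [← action_mul, inv_mul_cancel, action_one]

theorem action_action_inv (u : D.AffineWeylGroup) (μ : D.RootLattice) :
    D.action u (D.action u⁻¹ μ) = μ := by
  rw [← action_mul, mul_inv_cancel, action_one]

theorem action_s_apply (i : I) (μ : D.RootLattice) :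
    D.action (D.s i) μ = μ - D.simpleCoroot i μ • D.simpleRoot i := by
  rw [action_s, simpleReflection_apply]

theorem simpleCoroot_self (i : I) : D.simpleCoroot i (D.simpleRoot i) = 2 := by
  rw [simpleCoroot_simpleRoot, D.diag]

theorem action_s_simpleRoot_self (i : I) :
    D.action (D.s i) (D.simpleRoot i) = -D.simpleRoot i := by
  rw [action_s_apply, simpleCoroot_self]; module

theorem simpleRoot_apply_self (i : I) : D.simpleRoot i i = 1 := by simp [simpleRoot]

theorem simpleRoot_apply_of_ne {i j : I} (h : j ≠ i) : D.simpleRoot i j = 0 := by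
  simp [simpleRoot, h]

theorem simpleRoot_nonneg (i : I) : 0 ≤ D.simpleRoot i := by
  intro j; by_cases h : j = i
  · subst h; simp [simpleRoot]
  · simp [simpleRoot, h]

theorem simpleRoot_injective : Function.Injective D.simpleRoot := by
  intro i j h
  by_contra hne
  have := congrFun h i
  rw [simpleRoot_apply_self, D.simpleRoot_apply_of_ne hne] at this
  exact one_ne_zero this

theorem action_simpleRoot_mem (w : D.AffineWeylGroup) (i : I) :
    D.action w (D.simpleRoot i) ∈ D.affineRoots := ⟨w, i, rfl⟩

theorem action_mem_affineRoots {β : D.RootLattice} (w : D.AffineWeylGroup)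
    (h : β ∈ D.affineRoots) : D.action w β ∈ D.affineRoots := by
  obtain ⟨u, i, rfl⟩ := h
  exact ⟨w * u, i, by rw [action_mul]⟩

theorem action_mul_s_simpleRoot (w : D.AffineWeylGroup) (i : I) :
    D.action (w * D.s i) (D.simpleRoot i) = -D.action w (D.simpleRoot i) := by
  rw [action_mul, action_s_simpleRoot_self, map_neg]

theorem neg_mem_affineRoots {β : D.RootLattice} (h : β ∈ D.affineRoots) :
    -β ∈ D.affineRoots := by
  obtain ⟨u, i, rfl⟩ := h
  exact ⟨u * D.s i, i, by rw [action_mul_s_simpleRoot]⟩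

/-- Affine roots are primitive vectors of the root lattice. -/
theorem eq_one_or_neg_one_of_eq_smul {β ν : D.RootLattice} (h : β ∈ D.affineRoots) {c : ℤ}
    (e : β = c • ν) :
    c = 1 ∨ c = -1 := by
  obtain ⟨u, i, rfl⟩ := h
  have h1 := congrArg (D.action u⁻¹) e
  rw [action_inv_action, map_smul] at h1
  have h2 := congrFun h1 i
  rw [simpleRoot_apply_self, Pi.smul_apply, smul_eq_mul] at h2
  exact Int.isUnit_iff.mp (IsUnit.of_mul_eq_one _ h2.symm)

theorem affineRoots_ne_zero {β : D.RootLattice} (h : β ∈ D.affineRoots) : β ≠ 0 := by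
  intro h0
  have := D.eq_one_or_neg_one_of_eq_smul h (c := 0) (ν := 0) (by simp [h0])
  omega

/-- A root supported at the single index `i` is `± α_i`. -/
theorem eq_simpleRoot_of_support {β : D.RootLattice} (h : β ∈ D.affineRoots) {i : I}
    (hs : ∀ j, j ≠ i → β j = 0) : β = D.simpleRoot i ∨ β = -D.simpleRoot i := by
  have e : β = β i • D.simpleRoot i := by
    ext j
    by_cases hj : j = i
    · subst hj; simp [simpleRoot]
    · simp [simpleRoot, hj, hs j hj]
  rcases D.eq_one_or_neg_one_of_eq_smul h e with h1 | h1
  · left; rw [e, h1, one_smul]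
  · right; rw [e, h1, neg_one_smul]

/-- The restriction of a simple reflection to the rank two lattice spanned by `α_i` and `α_j`. -/
theorem action_s_left (i j : I) (x y : ℤ) :
    D.action (D.s i) (x • D.simpleRoot i + y • D.simpleRoot j) =
      (-x - D.A i j * y) • D.simpleRoot i + y • D.simpleRoot j := by
  rw [action_s_apply, map_add, map_smul, map_smul, simpleCoroot_self, simpleCoroot_simpleRoot]
  module

theorem action_s_right (i j : I) (x y : ℤ) :
    D.action (D.s j) (x • D.simpleRoot i + y • D.simpleRoot j) =
      x • D.simpleRoot i + (-y - D.A j i * x) • D.simpleRoot j := by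
  rw [add_comm, action_s_left, add_comm]

/-- In the rank two subgroup generated by `s_i` and `s_j`, an alternating product of fewer than
`m_ij` factors that ends in `s_j` maps `α_i` to a nonnegative combination of `α_i` and `α_j`. -/
theorem exists_action_alternatingWord {i j : I} (hij : i ≠ j) (k : ℕ)
    (hk : D.coxeterMatrix i j ≠ 0 → k < D.coxeterMatrix i j) :
    ∃ x y : ℤ, 0 ≤ x ∧ 0 ≤ y ∧
      D.action (D.cs.wordProd (CoxeterSystem.alternatingWord i j k)) (D.simpleRoot i) =
        x • D.simpleRoot i + y • D.simpleRoot j := by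
  have hM : D.coxeterMatrix i j = coxeterEntry (D.A i j * D.A j i) := by
    change (if i = j then 1 else coxeterEntry (D.A i j * D.A j i)) = _
    rw [if_neg hij]
  rw [hM] at hk
  have base : D.action (D.cs.wordProd (CoxeterSystem.alternatingWord i j 0)) (D.simpleRoot i) =
      (1 : ℤ) • D.simpleRoot i + (0 : ℤ) • D.simpleRoot j := by
    simp [CoxeterSystem.alternatingWord, CoxeterSystem.wordProd]
  have step : ∀ n (x y : ℤ),
      D.action (D.cs.wordProd (CoxeterSystem.alternatingWord i j n)) (D.simpleRoot i) =
        x • D.simpleRoot i + y • D.simpleRoot j →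
      D.action (D.cs.wordProd (CoxeterSystem.alternatingWord i j (n + 1))) (D.simpleRoot i) =
        if Even n then x • D.simpleRoot i + (-y - D.A j i * x) • D.simpleRoot j
        else (-x - D.A i j * y) • D.simpleRoot i + y • D.simpleRoot j := by
    intro n x y h
    rw [CoxeterSystem.alternatingWord_succ', CoxeterSystem.wordProd_cons, action_mul, h]
    split_ifs
    · exact D.action_s_right i j x y
    · exact D.action_s_left i j x y
  have ha := D.nonpos i j hij
  have hb := D.nonpos j i hij.symm
  have hz := D.zero_iff i j
  generalize D.A i j = a at *
  generalize D.A j i = b at *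
  have s1 := step 0 _ _ base
  have s2 := step 1 _ _ s1
  have s3 := step 2 _ _ s2
  have s4 := step 3 _ _ s3
  have s5 := step 4 _ _ s4
  by_cases h4 : 4 ≤ a * b
  · -- the two bounds are exchanged by the two reflections
    suffices H : ∃ x y : ℤ, 0 ≤ x ∧ 0 ≤ y ∧
        (if Even k then 2 * y ≤ -b * x else 2 * x ≤ -a * y) ∧
        D.action (D.cs.wordProd (CoxeterSystem.alternatingWord i j k)) (D.simpleRoot i) =
          x • D.simpleRoot i + y • D.simpleRoot j by
      obtain ⟨x, y, hx, hy, -, h⟩ := H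
      exact ⟨x, y, hx, hy, h⟩
    clear hk s1 s2 s3 s4 s5
    induction k with
    | zero => exact ⟨1, 0, by norm_num, le_rfl, by simp; omega, base⟩
    | succ n ih =>
      obtain ⟨x, y, hx, hy, hxy, h⟩ := ih
      have h' := step n x y h
      by_cases hn : Even n
      · rw [if_pos hn] at hxy h'
        refine ⟨_, _, hx, by nlinarith, ?_, h'⟩
        rw [if_neg (by simpa [Nat.even_add_one] using hn)]
        nlinarith
      · rw [if_neg hn] at hxy h'
        refine ⟨_, _, by nlinarith, hy, ?_, h'⟩
        rw [if_pos (by simpa [Nat.even_add_one] using hn)]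
        nlinarith
  · have key : (a = 0 ∧ b = 0) ∨ (a = -1 ∧ b = -1) ∨ (a = -1 ∧ b = -2) ∨ (a = -2 ∧ b = -1) ∨
        (a = -1 ∧ b = -3) ∨ (a = -3 ∧ b = -1) := by
      by_cases h0 : a = 0
      · exact Or.inl ⟨h0, hz.1 h0⟩
      have hb0 : b ≠ 0 := fun h => h0 (hz.2 h)
      have h1 : -3 ≤ a := by nlinarith [(show b ≤ -1 by omega)]
      have h2 : -3 ≤ b := by nlinarith [(show a ≤ -1 by omega)]
      interval_cases a <;> interval_cases b <;> simp_all
    have e1 : ¬ Even 1 := by decide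
    have e2 : Even 2 := by decide
    have e3 : ¬ Even 3 := by decide
    have e4 : Even 4 := by decide
    simp only [Even.zero, e1, e2, e3, e4, if_true, if_false, zero_add, Nat.reduceAdd]
      at s1 s2 s3 s4 s5
    rcases key with ⟨rfl, rfl⟩ | ⟨rfl, rfl⟩ | ⟨rfl, rfl⟩ | ⟨rfl, rfl⟩ | ⟨rfl, rfl⟩ | ⟨rfl, rfl⟩
    · have hk := hk (by decide)
      rw [show coxeterEntry (0 * 0) = 2 from rfl] at hk
      interval_cases k
      exacts [⟨_, _, by norm_num, by norm_num, base⟩, ⟨_, _, by norm_num, by norm_num, s1⟩]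
    · have hk := hk (by decide)
      rw [show coxeterEntry (-1 * -1) = 3 from rfl] at hk
      interval_cases k
      exacts [⟨_, _, by norm_num, by norm_num, base⟩, ⟨_, _, by norm_num, by norm_num, s1⟩,
        ⟨_, _, by norm_num, by norm_num, s2⟩]
    · have hk := hk (by decide)
      rw [show coxeterEntry (-1 * -2) = 4 from rfl] at hk
      interval_cases k
      exacts [⟨_, _, by norm_num, by norm_num, base⟩, ⟨_, _, by norm_num, by norm_num, s1⟩,
        ⟨_, _, by norm_num, by norm_num, s2⟩, ⟨_, _, by norm_num, by norm_num, s3⟩]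
    · have hk := hk (by decide)
      rw [show coxeterEntry (-2 * -1) = 4 from rfl] at hk
      interval_cases k
      exacts [⟨_, _, by norm_num, by norm_num, base⟩, ⟨_, _, by norm_num, by norm_num, s1⟩,
        ⟨_, _, by norm_num, by norm_num, s2⟩, ⟨_, _, by norm_num, by norm_num, s3⟩]
    · have hk := hk (by decide)
      rw [show coxeterEntry (-1 * -3) = 6 from rfl] at hk
      interval_cases k
      exacts [⟨_, _, by norm_num, by norm_num, base⟩, ⟨_, _, by norm_num, by norm_num, s1⟩,
        ⟨_, _, by norm_num, by norm_num, s2⟩, ⟨_, _, by norm_num, by norm_num, s3⟩,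
        ⟨_, _, by norm_num, by norm_num, s4⟩, ⟨_, _, by norm_num, by norm_num, s5⟩]
    · have hk := hk (by decide)
      rw [show coxeterEntry (-3 * -1) = 6 from rfl] at hk
      interval_cases k
      exacts [⟨_, _, by norm_num, by norm_num, base⟩, ⟨_, _, by norm_num, by norm_num, s1⟩,
        ⟨_, _, by norm_num, by norm_num, s2⟩, ⟨_, _, by norm_num, by norm_num, s3⟩,
        ⟨_, _, by norm_num, by norm_num, s4⟩, ⟨_, _, by norm_num, by norm_num, s5⟩]

open CoxeterSystem in
/-- If `w s_i` is longer than `w`, then `w α_i` is a positive root. The proof splits off from `w` on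
the right the longest possible alternating product of `s_i` and a descent `s_j`; what remains is a
shorter element for which both `i` and `j` are ascents. -/
theorem action_simpleRoot_nonneg {w : D.AffineWeylGroup} {i : I}
    (h : D.length w < D.length (w * D.s i)) : 0 ≤ D.action w (D.simpleRoot i) := by
  induction hn : D.length w using Nat.strong_induction_on generalizing w i with
  | _ n ih =>
  subst hn
  by_cases hw : w = 1
  · subst hw; rw [action_one]; exact D.simpleRoot_nonneg i
  obtain ⟨j, hj⟩ := D.exists_descent hw
  have hij : i ≠ j := by rintro rfl; omega
  let p : ℕ → D.AffineWeylGroup := fun k => D.cs.wordProd (alternatingWord i j k)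
  have p0 : p 0 = 1 := by simp [p, alternatingWord, wordProd]
  have psucc : ∀ k, p (k + 1) = (if Even k then D.s j else D.s i) * p k := by
    intro k
    simp only [p, alternatingWord_succ', wordProd_cons]
    split_ifs <;> rfl
  let P : ℕ → Prop := fun k => D.length (w * (p k)⁻¹) + k = D.length w
  have hex : ∃ k, ¬ P (k + 1) := ⟨D.length w, by simp only [P]; omega⟩
  classical
  set k := Nat.find hex with hk
  have hnk : ¬ P (k + 1) := Nat.find_spec hex
  have hP : ∀ l ≤ k, P l := by
    intro l hl
    rcases l with _ | l
    · simp [P, p0]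
    · by_contra hc
      have := Nat.find_min' hex hc
      omega
  have hk1 : 1 ≤ k := by
    rcases Nat.eq_zero_or_pos k with h0 | h0
    · exfalso
      rw [h0] at hnk
      apply hnk
      have hp1 : p 1 = D.s j := by rw [psucc 0, p0]; simp
      have := D.length_mul_s w j
      have hinv : (D.s j)⁻¹ = D.s j := D.cs.inv_simple j
      simp only [P, hp1, zero_add, hinv]
      omega
    · exact h0
  have hkm : D.coxeterMatrix i j ≠ 0 → k < D.coxeterMatrix i j := by
    intro hm0
    by_contra hle
    set m := D.coxeterMatrix i j with hm
    have h1 := hP m (by omega)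
    have h2 : p m = D.cs.wordProd (alternatingWord j i m) := by
      have := D.cs.prod_alternatingWord_eq_prod_alternatingWord_sub i j m (by omega)
      rwa [show D.coxeterMatrix i j * 2 - m = m by omega] at this
    obtain ⟨m', hm'⟩ := Nat.exists_eq_succ_of_ne_zero hm0
    have h3 : p m = D.cs.wordProd (alternatingWord i j m') * D.s i := by
      rw [h2, hm', Nat.succ_eq_add_one, alternatingWord_succ, wordProd_concat]; rfl
    have h4 : w * D.s i = w * (p m)⁻¹ * D.cs.wordProd (alternatingWord i j m') := by
      have : D.cs.wordProd (alternatingWord i j m') = p m * D.s i := by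
        rw [h3, mul_assoc, s_mul_s, mul_one]
      rw [this]; group
    have h5 := D.cs.length_mul_le (w * (p m)⁻¹) (D.cs.wordProd (alternatingWord i j m'))
    have h6 := D.cs.length_wordProd_le (alternatingWord i j m')
    rw [length_alternatingWord] at h6
    rw [← h4] at h5
    simp only [P, length_eq] at h1 h h5
    omega
  obtain ⟨x, y, hx, hy, hxy⟩ := D.exists_action_alternatingWord hij k hkm
  set v := w * (p k)⁻¹ with hv
  have hvk : D.length v + k = D.length w := hP k le_rfl
  have hw' : w = v * p k := by rw [hv]; group
  -- the letter that would extend the alternating word is an ascent of `v` by maximality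
  have asc1 : D.length v < D.length (v * (if Even k then D.s j else D.s i)) := by
    have e : w * (p (k + 1))⁻¹ = v * (if Even k then D.s j else D.s i) := by
      rw [psucc, hv, mul_inv_rev, mul_assoc]
      congr 2
      split_ifs
      exacts [D.cs.inv_simple j, D.cs.inv_simple i]
    simp only [P, e] at hnk
    split_ifs at hnk ⊢
    · have := D.length_mul_s v j; omega
    · have := D.length_mul_s v i; omega
  obtain ⟨l, hl⟩ : ∃ l, k = l + 1 := ⟨k - 1, by omega⟩
  -- the first letter of the alternating word is an ascent of `v` by length
  have asc2 : D.length v < D.length (v * (if Even l then D.s j else D.s i)) := by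
    have e : w * (p l)⁻¹ = v * (if Even l then D.s j else D.s i) := by
      rw [hv, hl, psucc]
      have : ((if Even l then D.s j else D.s i) : D.AffineWeylGroup) *
          (if Even l then D.s j else D.s i) = 1 := by
        split_ifs <;> exact D.s_mul_s _
      rw [mul_inv_rev, mul_assoc, mul_assoc, inv_mul_cancel, mul_one]
    have := hP l (by omega)
    simp only [P, e] at this
    omega
  have hvij : D.length v < D.length (v * D.s i) ∧ D.length v < D.length (v * D.s j) := by
    rw [hl] at asc1
    by_cases he : Even l
    · simp only [he, Nat.even_add_one, not_true_eq_false, if_true, if_false] at asc1 asc2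
      exact ⟨asc1, asc2⟩
    · simp only [he, Nat.even_add_one, not_false_eq_true, if_true, if_false] at asc1 asc2
      exact ⟨asc2, asc1⟩
  have hi := ih _ (by omega) hvij.1 rfl
  have hj := ih _ (by omega) hvij.2 rfl
  rw [hw', action_mul]
  change 0 ≤ D.action v (D.action (D.cs.wordProd (alternatingWord i j k)) (D.simpleRoot i))
  rw [hxy, map_add, map_smul, map_smul]
  exact add_nonneg (smul_nonneg hx hi) (smul_nonneg hy hj)

theorem action_simpleRoot_nonpos {w : D.AffineWeylGroup} {i : I}
    (h : D.length (w * D.s i) < D.length w) : D.action w (D.simpleRoot i) ≤ 0 := by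
  have := D.action_simpleRoot_nonneg (w := w * D.s i) (i := i)
    (by rwa [mul_assoc, s_mul_s, mul_one])
  rw [action_mul_s_simpleRoot] at this
  exact neg_nonneg.mp this

/-- Every root is positive or negative. -/
theorem nonneg_or_nonpos {β : D.RootLattice} (h : β ∈ D.affineRoots) : 0 ≤ β ∨ β ≤ 0 := by
  obtain ⟨w, i, rfl⟩ := h
  rcases D.length_mul_s w i with h | h
  · exact Or.inl (D.action_simpleRoot_nonneg (by omega))
  · exact Or.inr (D.action_simpleRoot_nonpos (by omega))

theorem not_nonneg_of_nonpos {β : D.RootLattice} (h : β ∈ D.affineRoots) (h1 : β ≤ 0) :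
    ¬ 0 ≤ β := fun h0 => D.affineRoots_ne_zero h (le_antisymm h1 h0)

/-- `s_i` permutes the positive roots other than `α_i`. -/
theorem action_s_nonneg {β : D.RootLattice} (h : β ∈ D.affineRoots) (h0 : 0 ≤ β) {i : I}
    (hne : β ≠ D.simpleRoot i) : 0 ≤ D.action (D.s i) β := by
  rcases D.nonneg_or_nonpos (D.action_mem_affineRoots (D.s i) h) with h1 | h1
  · exact h1
  exfalso
  -- the other coordinates do not change, so they vanish
  have hs : ∀ j, j ≠ i → β j = 0 := by
    intro j hj
    have h2 := h1 j
    rw [action_s_apply] at h2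
    simp only [Pi.sub_apply, Pi.smul_apply, D.simpleRoot_apply_of_ne hj, smul_zero, sub_zero] at h2
    exact le_antisymm h2 (h0 j)
  rcases D.eq_simpleRoot_of_support h hs with e | e
  · exact hne e
  · have := h0 i
    rw [e] at this
    simp [simpleRoot] at this

/-- The affine Weyl group acts faithfully on the root lattice. -/
theorem eq_one_of_action {w : D.AffineWeylGroup} (h : ∀ μ, D.action w μ = μ) : w = 1 := by
  by_contra hw
  obtain ⟨i, hi⟩ := D.exists_descent hw
  have := D.action_simpleRoot_nonpos hi
  rw [h] at this
  have := this i
  simp [simpleRoot] at this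

theorem eq_of_action {u w : D.AffineWeylGroup} (h : ∀ μ, D.action u μ = D.action w μ) :
    u = w := by
  have : w⁻¹ * u = 1 := D.eq_one_of_action fun μ => by rw [action_mul, h, action_inv_action]
  rw [← inv_mul_eq_one.mp this]

/-! ### The invariant form and reflections -/

/-- A positive diagonal matrix that symmetrizes the Cartan matrix. -/
noncomputable def weight : I → ℝ := D.posDef.choose

theorem weight_pos (i : I) : 0 < D.weight i := D.posDef.choose_spec.1 i

theorem weight_mul_comm (i j : I) : D.weight i * D.A i j = D.weight j * D.A j i := by
  have := D.posDef.choose_spec.2.1.apply i j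
  simpa [Matrix.diagonal_mul, weight] using this.symm

/-- The symmetric bilinear form on the real span of the simple affine roots given by the symmetrized
Cartan matrix. -/
noncomputable def form (x y : I → ℝ) : ℝ := ∑ i, ∑ j, x i * (D.weight i * D.A i j) * y j

theorem form_comm (x y : I → ℝ) : D.form x y = D.form y x := by
  unfold form
  rw [Finset.sum_comm]
  refine Finset.sum_congr rfl fun i _ => Finset.sum_congr rfl fun j _ => ?_
  rw [D.weight_mul_comm i j]; ring

theorem form_sub_left (x y z : I → ℝ) : D.form (x - y) z = D.form x z - D.form y z := by
  simp only [form, ← Finset.sum_sub_distrib, Pi.sub_apply]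
  exact Finset.sum_congr rfl fun i _ => Finset.sum_congr rfl fun j _ => by ring

theorem form_smul_left (c : ℝ) (x y : I → ℝ) : D.form (c • x) y = c * D.form x y := by
  simp only [form, Finset.mul_sum, Pi.smul_apply, smul_eq_mul]
  exact Finset.sum_congr rfl fun i _ => Finset.sum_congr rfl fun j _ => by ring

theorem form_sub_right (x y z : I → ℝ) : D.form z (x - y) = D.form z x - D.form z y := by
  rw [form_comm, form_sub_left, D.form_comm x, D.form_comm y]

theorem form_smul_right (c : ℝ) (x y : I → ℝ) : D.form y (c • x) = c * D.form y x := by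
  rw [form_comm, form_smul_left, form_comm]

theorem form_single (i : I) (y : I → ℝ) :
    D.form (Pi.single i 1) y = D.weight i * ∑ j, D.A i j * y j := by
  unfold form
  rw [Finset.sum_eq_single i (fun k _ hk => by simp [hk]) (by simp), Finset.mul_sum]
  exact Finset.sum_congr rfl fun j _ => by simp [mul_assoc]

/-- The coordinates of an element of the affine root lattice, as real numbers. -/
def toReal (μ : D.RootLattice) : I → ℝ := fun i => (μ i : ℝ)

theorem simpleCoroot_apply (i : I) (μ : D.RootLattice) :
    D.simpleCoroot i μ = ∑ j, D.A i j * μ j := by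
  simp [simpleCoroot, Matrix.mulVec, dotProduct]

theorem form_simpleRoot (i : I) (μ : D.RootLattice) :
    D.form (Pi.single i 1) (D.toReal μ) = D.weight i * D.simpleCoroot i μ := by
  rw [form_single, simpleCoroot_apply]; push_cast; rfl

theorem toReal_simpleRoot (i : I) : D.toReal (D.simpleRoot i) = Pi.single i 1 := by
  ext j
  by_cases h : j = i
  · subst h; simp [toReal, simpleRoot]
  · simp [toReal, simpleRoot, h]

theorem toReal_action_s (i : I) (μ : D.RootLattice) :
    D.toReal (D.action (D.s i) μ) =
      D.toReal μ - (D.simpleCoroot i μ : ℝ) • (Pi.single i 1 : I → ℝ) := by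
  rw [action_s_apply, ← D.toReal_simpleRoot]
  ext j; simp [toReal]

theorem form_action_s (i : I) (μ ν : D.RootLattice) :
    D.form (D.toReal (D.action (D.s i) μ)) (D.toReal (D.action (D.s i) ν)) =
      D.form (D.toReal μ) (D.toReal ν) := by
  have h : D.form (Pi.single i 1) (Pi.single i 1) = D.weight i * 2 := by
    have := D.form_simpleRoot i (D.simpleRoot i)
    rw [toReal_simpleRoot, simpleCoroot_self] at this
    exact_mod_cast this
  rw [toReal_action_s, toReal_action_s]
  simp only [form_sub_left, form_sub_right, form_smul_left, form_smul_right, h, form_simpleRoot,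
    D.form_comm (D.toReal μ) (Pi.single i 1)]
  ring

theorem form_action (w : D.AffineWeylGroup) (μ ν : D.RootLattice) :
    D.form (D.toReal (D.action w μ)) (D.toReal (D.action w ν)) =
      D.form (D.toReal μ) (D.toReal ν) := by
  induction w using D.cs.simple_induction_left generalizing μ ν with
  | one => simp only [action_one]
  | mul_simple_left w i ih => rw [cs_simple, action_mul, action_mul, form_action_s, ih]

theorem form_simpleRoot_self (i : I) :
    D.form (D.toReal (D.simpleRoot i)) (D.toReal (D.simpleRoot i)) = 2 * D.weight i := by
  nth_rw 1 [toReal_simpleRoot]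
  rw [form_simpleRoot, simpleCoroot_self]; push_cast; ring

/-- Coroots are determined by roots. -/
theorem simpleCoroot_action_inv {x : D.AffineWeylGroup} {k i : I}
    (h : D.action x (D.simpleRoot k) = D.simpleRoot i) (χ : D.RootLattice) :
    D.simpleCoroot k (D.action x⁻¹ χ) = D.simpleCoroot i χ := by
  have h1 : D.weight k = D.weight i := by
    have := D.form_action x (D.simpleRoot k) (D.simpleRoot k)
    rw [h, form_simpleRoot_self, form_simpleRoot_self] at this
    linarith
  have h2 : D.form (D.toReal (D.simpleRoot k)) (D.toReal (D.action x⁻¹ χ)) =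
      D.form (D.toReal (D.simpleRoot i)) (D.toReal χ) := by
    rw [← D.form_action x, action_action_inv, h]
  rw [toReal_simpleRoot, toReal_simpleRoot, form_simpleRoot, form_simpleRoot, h1] at h2
  exact_mod_cast mul_left_cancel₀ (D.weight_pos i).ne' h2

theorem action_conj_s (x : D.AffineWeylGroup) (i : I) (χ : D.RootLattice) :
    D.action (x * D.s i * x⁻¹) χ =
      χ - D.simpleCoroot i (D.action x⁻¹ χ) • D.action x (D.simpleRoot i) := by
  rw [mul_assoc, action_mul, action_mul, action_s_apply, map_sub, map_smul, action_action_inv]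

/-- Reflections are determined by their roots. -/
theorem conj_s_eq_s {x : D.AffineWeylGroup} {k i : I}
    (h : D.action x (D.simpleRoot k) = D.simpleRoot i) : x * D.s k * x⁻¹ = D.s i := by
  refine D.eq_of_action fun χ => ?_
  rw [action_conj_s, D.simpleCoroot_action_inv h, h, action_s_apply]

/-- The positive root of a reflection is determined by the reflection. -/
theorem root_eq_of_conj_s_eq {x y : D.AffineWeylGroup} {i j : I}
    (h : x * D.s i * x⁻¹ = y * D.s j * y⁻¹) (hx : 0 ≤ D.action x (D.simpleRoot i))
    (hy : 0 ≤ D.action y (D.simpleRoot j)) :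
    D.action x (D.simpleRoot i) = D.action y (D.simpleRoot j) := by
  set β := D.action x (D.simpleRoot i) with hβ
  have hmem : β ∈ D.affineRoots := D.action_simpleRoot_mem x i
  have e := D.action_conj_s y j β
  rw [← h, action_conj_s, hβ, action_inv_action, simpleCoroot_self, ← hβ] at e
  have e2 : (2 : ℤ) • β = D.simpleCoroot j (D.action y⁻¹ β) • D.action y (D.simpleRoot j) :=
    sub_right_injective e
  have e3 := congrArg (D.action y⁻¹) e2
  rw [map_smul, map_smul, action_inv_action] at e3
  have hs : ∀ k, k ≠ j → D.action y⁻¹ β k = 0 := by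
    intro k hk
    have := congrFun e3 k
    simpa [simpleRoot, hk] using this
  rcases D.eq_simpleRoot_of_support (D.action_mem_affineRoots y⁻¹ hmem) hs with h1 | h1
  · rw [← h1, action_action_inv]
  · exfalso
    have h2 : β = -D.action y (D.simpleRoot j) := by rw [← map_neg, ← h1, action_action_inv]
    exact D.not_nonneg_of_nonpos hmem (by rw [h2]; exact neg_nonpos.mpr hy) hx

/-- The value at `χ` of the coroot attached to the positive root of the reflection `t`. -/
noncomputable def reflectionPairing (t : D.AffineWeylGroup) (χ : D.RootLattice) : ℤ :=
  Classical.epsilon fun n => ∃ x i, t = x * D.s i * x⁻¹ ∧ 0 ≤ D.action x (D.simpleRoot i) ∧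
    n = D.simpleCoroot i (D.action x⁻¹ χ)

theorem reflectionPairing_eq {x : D.AffineWeylGroup} {i : I}
    (hx : 0 ≤ D.action x (D.simpleRoot i)) (χ : D.RootLattice) :
    D.reflectionPairing (x * D.s i * x⁻¹) χ = D.simpleCoroot i (D.action x⁻¹ χ) := by
  obtain ⟨y, j, h, hy, e⟩ := Classical.epsilon_spec (p := fun n => ∃ y j,
    x * D.s i * x⁻¹ = y * D.s j * y⁻¹ ∧ 0 ≤ D.action y (D.simpleRoot j) ∧
    n = D.simpleCoroot j (D.action y⁻¹ χ)) ⟨_, x, i, rfl, hx, rfl⟩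
  rw [reflectionPairing, e]
  have h1 := D.root_eq_of_conj_s_eq h hx hy
  have h2 := D.action_conj_s y j χ
  rw [← h, action_conj_s, h1] at h2
  have h3 : D.simpleCoroot i (D.action x⁻¹ χ) • D.action y (D.simpleRoot j) =
      D.simpleCoroot j (D.action y⁻¹ χ) • D.action y (D.simpleRoot j) :=
    sub_right_injective h2
  exact (smul_left_injective ℤ
    (D.affineRoots_ne_zero (D.action_simpleRoot_mem y j)) h3).symm

theorem reflectionPairing_s (i : I) (χ : D.RootLattice) :
    D.reflectionPairing (D.s i) χ = D.simpleCoroot i χ := by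
  have := D.reflectionPairing_eq (x := 1) (i := i)
    (by rw [action_one]; exact D.simpleRoot_nonneg i) χ
  simpa [action_one] using this

theorem exists_conj_s {t : D.AffineWeylGroup} (ht : D.cs.IsReflection t) :
    ∃ x i, t = x * D.s i * x⁻¹ ∧ 0 ≤ D.action x (D.simpleRoot i) := by
  obtain ⟨x, i, rfl⟩ := ht
  rcases D.nonneg_or_nonpos (D.action_simpleRoot_mem x i) with h | h
  · exact ⟨x, i, rfl, h⟩
  · refine ⟨x * D.s i, i, ?_, ?_⟩
    · have hinv : (D.s i)⁻¹ = D.s i := D.cs.inv_simple i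
      rw [mul_inv_rev, hinv, cs_simple, mul_assoc x (D.s i) (D.s i), s_mul_s, mul_one, mul_assoc]
    · rw [action_mul_s_simpleRoot]; exact neg_nonneg.mpr h

theorem reflectionPairing_conj {t : D.AffineWeylGroup} (ht : D.cs.IsReflection t) {i : I}
    (hne : t ≠ D.s i) (χ : D.RootLattice) :
    D.reflectionPairing (D.s i * t * D.s i) χ = D.reflectionPairing t (D.action (D.s i) χ) := by
  obtain ⟨x, k, rfl, hx⟩ := D.exists_conj_s ht
  have hinv : (D.s i)⁻¹ = D.s i := D.cs.inv_simple i
  have e : D.s i * (x * D.s k * x⁻¹) * D.s i = (D.s i * x) * D.s k * (D.s i * x)⁻¹ := by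
    rw [mul_inv_rev, hinv]; simp only [mul_assoc]
  have h1 : 0 ≤ D.action (D.s i * x) (D.simpleRoot k) := by
    rw [action_mul]
    exact D.action_s_nonneg (D.action_simpleRoot_mem x k) hx fun h => hne (D.conj_s_eq_s h)
  rw [e, D.reflectionPairing_eq h1, D.reflectionPairing_eq hx, mul_inv_rev, hinv, action_mul]

/-- If a word maps the positive root of a reflection `t` to a negative root, then the sign changes
at some letter, and so `t` occurs in the right inversion sequence. -/
theorem mem_rightInvSeq {x : D.AffineWeylGroup} {k : I} (hx : 0 ≤ D.action x (D.simpleRoot k))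
    {ω : List I} (h : D.action (D.cs.wordProd ω * x) (D.simpleRoot k) ≤ 0) :
    x * D.s k * x⁻¹ ∈ D.cs.rightInvSeq ω := by
  induction ω using List.reverseRecOn generalizing x with
  | nil =>
    exfalso
    rw [CoxeterSystem.wordProd_nil, one_mul] at h
    exact D.not_nonneg_of_nonpos (D.action_simpleRoot_mem x k) h hx
  | append_singleton ω i ih =>
    rw [← List.concat_eq_append] at h ⊢
    rw [CoxeterSystem.rightInvSeq_concat, List.concat_eq_append, List.mem_append]
    by_cases he : D.action x (D.simpleRoot k) = D.simpleRoot i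
    · right; rw [D.conj_s_eq_s he]; exact List.mem_singleton_self _
    left
    rw [CoxeterSystem.wordProd_concat, cs_simple, mul_assoc] at h
    have hinv : (D.s i)⁻¹ = D.s i := D.cs.inv_simple i
    have h1 : 0 ≤ D.action (D.s i * x) (D.simpleRoot k) := by
      rw [action_mul]; exact D.action_s_nonneg (D.action_simpleRoot_mem x k) hx he
    refine List.mem_map.mpr ⟨_, ih h1 h, ?_⟩
    rw [cs_simple, MulAut.conj_apply, mul_inv_rev, hinv]
    simp only [mul_assoc, s_mul_s, mul_one]
    rw [← mul_assoc (D.s i) (D.s i), s_mul_s, one_mul]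

/-- The right inversion sequence of a word contains all right inversions of its product. -/
theorem mem_rightInvSeq_of_isRightInversion {ω : List I} {t : D.AffineWeylGroup}
    (ht : D.cs.IsRightInversion (D.cs.wordProd ω) t) : t ∈ D.cs.rightInvSeq ω := by
  obtain ⟨x, k, rfl, hx⟩ := D.exists_conj_s ht.1
  rcases D.nonneg_or_nonpos (D.action_simpleRoot_mem (D.cs.wordProd ω * x) k) with h | h
  · -- otherwise `t` is a right inversion of the shorter element `v t` as well
    exfalso
    obtain ⟨ω', hω', e⟩ := D.cs.exists_isReduced (D.cs.wordProd ω * (x * D.s k * x⁻¹))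
    have h1 : D.action (D.cs.wordProd ω' * x) (D.simpleRoot k) ≤ 0 := by
      rw [← e, show D.cs.wordProd ω * (x * D.s k * x⁻¹) * x = D.cs.wordProd ω * x * D.s k by group,
        action_mul_s_simpleRoot]
      exact neg_nonpos.mpr h
    have h2 := (D.cs.isRightInversion_of_mem_rightInvSeq hω' (D.mem_rightInvSeq hx h1)).2
    have h3 := ht.2
    rw [← e, mul_assoc, ht.1.mul_self, mul_one] at h2
    omega
  · exact D.mem_rightInvSeq hx h

theorem rightInvSeq_perm {ω ω' : List I} (h : D.cs.IsReduced ω) (h' : D.cs.IsReduced ω')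
    (e : D.cs.wordProd ω = D.cs.wordProd ω') :
    (D.cs.rightInvSeq ω).Perm (D.cs.rightInvSeq ω') := by
  rw [List.perm_ext_iff_of_nodup h.nodup_rightInvSeq h'.nodup_rightInvSeq]
  exact fun t =>
    ⟨fun ht => D.mem_rightInvSeq_of_isRightInversion
      (e ▸ D.cs.isRightInversion_of_mem_rightInvSeq h ht),
    fun ht => D.mem_rightInvSeq_of_isRightInversion
      (e ▸ D.cs.isRightInversion_of_mem_rightInvSeq h' ht)⟩

/-! ### The nilCoxeter generators and the Chevalley operators -/

theorem toPolynomial_sub (μ ν : D.RootLattice) :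
    D.toPolynomial (μ - ν) = D.toPolynomial μ - D.toPolynomial ν := by
  simp [toPolynomial, sub_mul, Finset.sum_sub_distrib]

theorem toPolynomial_zsmul (c : ℤ) (μ : D.RootLattice) :
    D.toPolynomial (c • μ) = (c : MvPolynomial I ℤ) * D.toPolynomial μ := by
  simp [toPolynomial, Finset.mul_sum, mul_assoc]

theorem toPolynomial_injective : Function.Injective D.toPolynomial := by
  have key : ∀ (μ : D.RootLattice) i,
      MvPolynomial.coeff (Finsupp.single i 1) (D.toPolynomial μ) = μ i := by
    intro μ i
    rw [toPolynomial, MvPolynomial.coeff_sum, Finset.sum_eq_single i]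
    · rw [MvPolynomial.coeff_C_mul, MvPolynomial.coeff_X, if_pos rfl, mul_one]
    · intro j _ hj
      rw [MvPolynomial.coeff_C_mul, MvPolynomial.coeff_X, if_neg, mul_zero]
      exact fun h => hj (Finsupp.single_left_injective one_ne_zero h)
    · simp
  intro μ ν h
  ext i
  rw [← key μ, h, key]

/-- The free module over the polynomial ring with basis `e_v`, where `v` runs over the affine Weyl
group. -/
abbrev NilModule : Type _ := D.AffineWeylGroup →₀ MvPolynomial I ℤ

/-- The generator of the nilCoxeter algebra acting from the right: `e_v ↦ e_{v s_i}` if `v s_i` is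
longer than `v`, and `e_v ↦ 0` otherwise. -/
noncomputable def nilOp (i : I) : D.NilModule →ₗ[MvPolynomial I ℤ] D.NilModule :=
  Finsupp.linearCombination _ fun v =>
    if D.length v < D.length (v * D.s i) then Finsupp.single (v * D.s i) 1 else 0

theorem nilOp_single_of_lt {v : D.AffineWeylGroup} {i : I} (h : D.length v < D.length (v * D.s i))
    (p : MvPolynomial I ℤ) :
    D.nilOp i (Finsupp.single v p) = Finsupp.single (v * D.s i) p := by
  rw [nilOp, Finsupp.linearCombination_single, if_pos h, Finsupp.smul_single, smul_eq_mul, mul_one]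

theorem nilOp_single_of_not_lt {v : D.AffineWeylGroup} {i : I}
    (h : ¬ D.length v < D.length (v * D.s i)) (p : MvPolynomial I ℤ) :
    D.nilOp i (Finsupp.single v p) = 0 := by
  rw [nilOp, Finsupp.linearCombination_single, if_neg h, smul_zero]

theorem nilOp_nilOp (i : I) (m : D.NilModule) : D.nilOp i (D.nilOp i m) = 0 := by
  induction m using Finsupp.induction_linear with
  | zero => simp
  | add f g hf hg => rw [map_add, map_add, hf, hg, add_zero]
  | single v p =>
    by_cases h : D.length v < D.length (v * D.s i)
    · rw [D.nilOp_single_of_lt h, D.nilOp_single_of_not_lt]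
      rw [mul_assoc, s_mul_s, mul_one]; omega
    · rw [D.nilOp_single_of_not_lt h, map_zero]

theorem nilOp_apply_one (i : I) (m : D.NilModule) : D.nilOp i m 1 = 0 := by
  induction m using Finsupp.induction_linear with
  | zero => simp
  | add f g hf hg => rw [map_add, Finsupp.add_apply, hf, hg, add_zero]
  | single v p =>
    by_cases h : D.length v < D.length (v * D.s i)
    · rw [D.nilOp_single_of_lt h]
      refine Finsupp.single_eq_of_ne fun h1 => ?_
      rw [← h1, length_one] at h
      omega
    · rw [D.nilOp_single_of_not_lt h, Finsupp.zero_apply]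

/-- The term of the Chevalley formula for `χ · e_v` that belongs to the reflection `t`. -/
noncomputable def chevalleyTerm (χ : D.RootLattice) (v t : D.AffineWeylGroup) : D.NilModule :=
  if D.length (v * t) + 1 = D.length v then
    Finsupp.single (v * t) (D.reflectionPairing t χ : MvPolynomial I ℤ) else 0

/-- The right hand side of the Chevalley formula for `χ · e_v`, written with a word for `v`: the
reflections `t` run over the right inversion sequence of the word. -/
noncomputable def chevalleyWord (χ : D.RootLattice) (ω : List I) : D.NilModule :=
  Finsupp.single (D.cs.wordProd ω) (D.toPolynomial (D.action (D.cs.wordProd ω) χ)) -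
    ((D.cs.rightInvSeq ω).map (D.chevalleyTerm χ (D.cs.wordProd ω))).sum

theorem chevalleyWord_eq (χ : D.RootLattice) {ω ω' : List I} (h : D.cs.IsReduced ω)
    (h' : D.cs.IsReduced ω') (e : D.cs.wordProd ω = D.cs.wordProd ω') :
    D.chevalleyWord χ ω = D.chevalleyWord χ ω' := by
  rw [chevalleyWord, chevalleyWord, e, ((D.rightInvSeq_perm h h' e).map _).sum_eq]

/-- The Chevalley operator of `χ`: the action of `χ` from the right on the nilHecke ring, in which
`e_v χ = (v χ) e_v - ∑ ⟨γ_t^∨, χ⟩ e_{v t}`, the sum running over the reflections `t` with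
`ℓ(v t) = ℓ(v) - 1`. -/
noncomputable def chevalley (χ : D.RootLattice) :
    D.NilModule →ₗ[MvPolynomial I ℤ] D.NilModule :=
  Finsupp.linearCombination _ fun v => D.chevalleyWord χ (D.cs.exists_isReduced v).choose

theorem chevalley_single (χ : D.RootLattice) {ω : List I} (h : D.cs.IsReduced ω) :
    D.chevalley χ (Finsupp.single (D.cs.wordProd ω) 1) = D.chevalleyWord χ ω := by
  have hs := (D.cs.exists_isReduced (D.cs.wordProd ω)).choose_spec
  rw [chevalley, Finsupp.linearCombination_single, one_smul]
  exact D.chevalleyWord_eq χ hs.1 h hs.2.symm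

theorem nilOp_chevalleyTerm {v t : D.AffineWeylGroup} {i : I} {χ : D.RootLattice}
    (hv : D.length v < D.length (v * D.s i)) (ht : D.cs.IsRightInversion v t) :
    D.nilOp i (D.chevalleyTerm (D.action (D.s i) χ) v t) =
      D.chevalleyTerm χ (v * D.s i) (D.s i * t * D.s i) := by
  have hti : t ≠ D.s i := by
    rintro rfl
    have := ht.2
    simp only [length_eq] at hv
    omega
  have e : v * D.s i * (D.s i * t * D.s i) = v * t * D.s i := by
    simp only [mul_assoc]
    rw [← mul_assoc (D.s i) (D.s i), s_mul_s, one_mul]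
  have h1 := D.length_mul_s v i
  have h2 := D.length_mul_s (v * t) i
  have h3 : D.length (v * t) < D.length v := ht.2
  rw [chevalleyTerm, chevalleyTerm, e, D.reflectionPairing_conj ht.1 hti]
  by_cases hl : D.length (v * t) + 1 = D.length v
  · rw [if_pos hl]
    by_cases hl' : D.length (v * t) < D.length (v * t * D.s i)
    · rw [D.nilOp_single_of_lt hl', if_pos (by omega)]
    · rw [D.nilOp_single_of_not_lt hl', if_neg (by omega)]
  · rw [if_neg hl, map_zero, if_neg (by omega)]

theorem chevalleyWord_concat (χ : D.RootLattice) {ω : List I} {i : I} (h : D.cs.IsReduced ω)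
    (hi : D.cs.IsReduced (ω.concat i)) :
    D.chevalleyWord χ (ω.concat i) = D.nilOp i (D.chevalleyWord (D.action (D.s i) χ) ω) -
      (D.simpleCoroot i χ : MvPolynomial I ℤ) • Finsupp.single (D.cs.wordProd ω) 1 := by
  have e : D.cs.wordProd (ω.concat i) = D.cs.wordProd ω * D.s i := D.cs.wordProd_concat i ω
  have hv : D.length (D.cs.wordProd ω) < D.length (D.cs.wordProd ω * D.s i) := by
    have h1 := hi.eq
    have h2 := h.eq
    rw [e, List.length_concat] at h1
    simp only [length_eq]
    omega
  have hlen : D.length (D.cs.wordProd ω) + 1 = D.length (D.cs.wordProd ω * D.s i) := by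
    have := D.length_mul_s (D.cs.wordProd ω) i; omega
  rw [chevalleyWord, chevalleyWord, e, CoxeterSystem.rightInvSeq_concat, List.concat_eq_append,
    List.map_append, List.sum_append, List.map_map, map_sub, D.nilOp_single_of_lt hv, action_mul,
    map_list_sum, List.map_map]
  have e1 : (D.cs.rightInvSeq ω).map (D.chevalleyTerm χ (D.cs.wordProd ω * D.s i) ∘
      ⇑(MulAut.conj (D.cs.simple i))) = (D.cs.rightInvSeq ω).map
      (⇑(D.nilOp i) ∘ D.chevalleyTerm (D.action (D.s i) χ) (D.cs.wordProd ω)) := by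
    refine List.map_congr_left fun t ht => ?_
    have hinv : (D.s i)⁻¹ = D.s i := D.cs.inv_simple i
    rw [Function.comp_apply, Function.comp_apply, MulAut.conj_apply, cs_simple, hinv,
      D.nilOp_chevalleyTerm hv (D.cs.isRightInversion_of_mem_rightInvSeq h ht)]
  have e2 : D.chevalleyTerm χ (D.cs.wordProd ω * D.s i) (D.cs.simple i) =
      (D.simpleCoroot i χ : MvPolynomial I ℤ) • Finsupp.single (D.cs.wordProd ω) 1 := by
    rw [chevalleyTerm, cs_simple, mul_assoc, s_mul_s, mul_one, if_pos hlen, reflectionPairing_s,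
      Finsupp.smul_single, smul_eq_mul, mul_one]
  rw [e1, List.map_singleton, List.sum_singleton, e2, sub_sub]

theorem chevalley_nilOp_single_of_lt (χ : D.RootLattice) {v : D.AffineWeylGroup} {i : I}
    (h : D.length v < D.length (v * D.s i)) :
    D.chevalley χ (Finsupp.single (v * D.s i) 1) =
      D.nilOp i (D.chevalley (D.action (D.s i) χ) (Finsupp.single v 1)) -
        (D.simpleCoroot i χ : MvPolynomial I ℤ) • Finsupp.single v 1 := by
  obtain ⟨ω, hω, rfl⟩ := D.cs.exists_isReduced v
  have e : D.cs.wordProd (ω.concat i) = D.cs.wordProd ω * D.s i := D.cs.wordProd_concat i ω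
  have hi : D.cs.IsReduced (ω.concat i) := by
    have := D.length_mul_s (D.cs.wordProd ω) i
    have h2 := hω.eq
    rw [CoxeterSystem.IsReduced, e, List.length_concat]
    simp only [length_eq] at this h
    omega
  rw [← e, D.chevalley_single χ hi, D.chevalley_single _ hω, D.chevalleyWord_concat χ hω hi]

/-- The commutation relation of the nilHecke ring. -/
theorem chevalley_nilOp (χ : D.RootLattice) (i : I) (m : D.NilModule) :
    D.chevalley χ (D.nilOp i m) = D.nilOp i (D.chevalley (D.action (D.s i) χ) m) -
      (D.simpleCoroot i χ : MvPolynomial I ℤ) • m := by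
  induction m using Finsupp.induction_linear with
  | zero => simp
  | add f g hf hg => simp only [map_add, hf, hg, smul_add]; abel
  | single v p =>
    rw [← mul_one p, ← smul_eq_mul, ← Finsupp.smul_single]
    simp only [map_smul]
    rw [smul_comm (D.simpleCoroot i χ : MvPolynomial I ℤ), ← smul_sub]
    congr 1
    by_cases h : D.length v < D.length (v * D.s i)
    · rw [D.nilOp_single_of_lt h, D.chevalley_nilOp_single_of_lt χ h]
    · -- write `v = v' s_i` with `v' < v` and use that `nilOp i` has square zero
      set v' := v * D.s i with hv'
      have hv : v = v' * D.s i := by rw [hv', mul_assoc, s_mul_s, mul_one]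
      have h' : D.length v' < D.length (v' * D.s i) := by
        rw [← hv]
        have := D.length_mul_s v i
        rw [← hv'] at this
        omega
      have hc : D.simpleCoroot i (D.action (D.s i) χ) = -D.simpleCoroot i χ := by
        rw [action_s_apply, map_sub, map_smul, simpleCoroot_self, smul_eq_mul]; ring
      rw [D.nilOp_single_of_not_lt (by rwa [← hv']), map_zero, hv,
        D.chevalley_nilOp_single_of_lt _ h', map_sub, nilOp_nilOp, map_smul,
        D.nilOp_single_of_lt h', hc]
      simp

/-- The Chevalley operator is triangular for the length function, with diagonal entries `v χ`. -/
theorem chevalley_apply_of_maximal (χ : D.RootLattice) (m : D.NilModule) {u : D.AffineWeylGroup}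
    (hu : ∀ v, D.length u < D.length v → m v = 0) :
    D.chevalley χ m u = D.toPolynomial (D.action u χ) * m u := by
  have hterm : ∀ v p, (D.length u < D.length v → p = 0) →
      D.chevalley χ (Finsupp.single v p) u =
        D.toPolynomial (D.action u χ) * (Finsupp.single v p : D.NilModule) u := by
    intro v p hp
    by_cases hlt : D.length u < D.length v
    · rw [hp hlt]; simp
    obtain ⟨ω, hω, rfl⟩ := D.cs.exists_isReduced v
    rw [← mul_one p, ← smul_eq_mul, ← Finsupp.smul_single, map_smul, D.chevalley_single χ hω,
      chevalleyWord, Finsupp.smul_apply, Finsupp.sub_apply]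
    have hz : ((D.cs.rightInvSeq ω).map (D.chevalleyTerm χ (D.cs.wordProd ω))).sum u = 0 := by
      rw [← Finsupp.applyAddHom_apply, map_list_sum, List.map_map]
      refine List.sum_eq_zero fun x hx => ?_
      obtain ⟨t, ht, rfl⟩ := List.mem_map.mp hx
      rw [Function.comp_apply, Finsupp.applyAddHom_apply, chevalleyTerm]
      split_ifs with hl
      · refine Finsupp.single_eq_of_ne fun h1 => ?_
        rw [← h1] at hl
        omega
      · rfl
    rw [hz, sub_zero, Finsupp.smul_apply]
    by_cases he : D.cs.wordProd ω = u
    · subst he; simp [mul_comm]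
    · simp [he]
  conv_lhs => rw [← m.sum_single]
  conv_rhs => rw [← m.sum_single]
  rw [Finsupp.sum, map_sum, Finsupp.finsetSum_apply, Finsupp.finsetSum_apply, Finset.mul_sum]
  exact Finset.sum_congr rfl fun v _ => hterm v _ (hu v)

/-- A common eigenvector of the Chevalley operators, with the eigenvalues `w χ`, vanishes if its
coefficient at `w` does. -/
theorem eq_zero_of_chevalley_eq {w : D.AffineWeylGroup} {m : D.NilModule}
    (h : ∀ χ, D.chevalley χ m = D.toPolynomial (D.action w χ) • m) (hw : m w = 0) : m = 0 := by
  by_contra hm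
  obtain ⟨u, hu, hmax⟩ := m.support.exists_max_image D.length (Finsupp.support_nonempty_iff.mpr hm)
  rw [Finsupp.mem_support_iff] at hu
  have huw : u = w := by
    refine D.eq_of_action fun χ => D.toPolynomial_injective (mul_right_cancel₀ hu ?_)
    rw [← D.chevalley_apply_of_maximal χ m, h, Finsupp.smul_apply, smul_eq_mul]
    intro v hv
    by_contra hne
    have := hmax v (Finsupp.mem_support_iff.mpr hne)
    omega
  exact hu (huw ▸ hw)

/-- The common eigenvector with the eigenvalues `w χ` whose coefficient at `1` is `1` is unique:
two of them are proportional over the fraction field. -/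
theorem eq_of_chevalley_eq {w : D.AffineWeylGroup} {m m' : D.NilModule}
    (h : ∀ χ, D.chevalley χ m = D.toPolynomial (D.action w χ) • m)
    (h' : ∀ χ, D.chevalley χ m' = D.toPolynomial (D.action w χ) • m')
    (h1 : m 1 = 1) (h1' : m' 1 = 1) : m = m' := by
  have h2 : m' w • (m - m') - (m - m') w • m' = 0 := by
    refine D.eq_zero_of_chevalley_eq (w := w) (fun χ => ?_) ?_
    · simp only [map_sub, map_smul, h, h', ← smul_sub]
      rw [smul_comm (m' w), smul_comm ((m - m') w), ← smul_sub]
    · simp [mul_comm]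
  have h3 : (m - m') w = 0 := by
    have := DFunLike.congr_fun h2 1
    rw [Finsupp.sub_apply, Finsupp.smul_apply, Finsupp.smul_apply, Finsupp.sub_apply m, h1, h1',
      sub_self, smul_zero, zero_sub, smul_eq_mul, mul_one, Finsupp.zero_apply] at this
    exact neg_eq_zero.mp this
  refine sub_eq_zero.mp (D.eq_zero_of_chevalley_eq (w := w) (fun χ => ?_) h3)
  rw [map_sub, h, h', smul_sub]

/-! ### Mask sums -/

/-- The basis element of the product of the subword of `t` selected by the mask `ε` if this
subword is reduced, and zero otherwise. -/
noncomputable def subwordElement {n : ℕ} (t : Fin n → I) (ε : Fin n → Bool) : D.NilModule :=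
  let x := (List.ofFn fun j => D.s (t j) ^ (ε j).toNat).prod
  if (Finset.univ.filter fun j => ε j = true).card = D.length x then Finsupp.single x 1 else 0

/-- The generating element `∑ Ψ^ε e_{w^ε}` of the mask sums for the word `t` and the roots `b`, the
sum running over all masks that select a reduced subword. -/
noncomputable def maskElement {n : ℕ} (t : Fin n → I) (b : Fin n → D.RootLattice) : D.NilModule :=
  ∑ ε : Fin n → Bool, (∏ j ∈ Finset.univ.filter (fun j => ε j = true), D.toPolynomial (b j)) •
    D.subwordElement t ε

theorem prod_ofFn_snoc {n : ℕ} (t : Fin (n + 1) → I) (ε : Fin n → Bool) (c : Bool) :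
    (List.ofFn fun j => D.s (t j) ^ ((Fin.snoc ε c : Fin (n + 1) → Bool) j).toNat).prod =
      (List.ofFn fun j => D.s (Fin.init t j) ^ (ε j).toNat).prod *
        D.s (t (Fin.last n)) ^ c.toNat := by
  rw [List.ofFn_succ', List.concat_eq_append, List.prod_append, List.prod_singleton, Fin.snoc_last]
  simp only [Fin.snoc_castSucc, Fin.init]

theorem card_filter_snoc {n : ℕ} (ε : Fin n → Bool) (c : Bool) :
    (Finset.univ.filter fun j => (Fin.snoc ε c : Fin (n + 1) → Bool) j = true).card =
      (Finset.univ.filter fun j => ε j = true).card + c.toNat := by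
  rw [Finset.card_filter, Finset.card_filter, Fin.sum_univ_castSucc, Fin.snoc_last]
  simp only [Fin.snoc_castSucc]
  cases c <;> simp

theorem length_subword_le {n : ℕ} (t : Fin n → I) (ε : Fin n → Bool) :
    D.length (List.ofFn fun j => D.s (t j) ^ (ε j).toNat).prod ≤
      (Finset.univ.filter fun j => ε j = true).card := by
  induction n with
  | zero => simp [length_one]
  | succ n ih =>
    rw [← Fin.snoc_init_self ε, prod_ofFn_snoc, card_filter_snoc]
    have h1 := ih (Fin.init t) (Fin.init ε)
    cases ε (Fin.last n)
    · simpa using h1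
    · have := D.length_mul_s (List.ofFn fun j => D.s (Fin.init t j) ^ (Fin.init ε j).toNat).prod
        (t (Fin.last n))
      rw [Bool.toNat_true, pow_one]
      omega

theorem subwordElement_snoc_false {n : ℕ} (t : Fin (n + 1) → I) (ε : Fin n → Bool) :
    D.subwordElement t (Fin.snoc ε false) = D.subwordElement (Fin.init t) ε := by
  simp only [subwordElement, prod_ofFn_snoc, card_filter_snoc, Bool.toNat_false, pow_zero, mul_one,
    add_zero]

theorem subwordElement_snoc_true {n : ℕ} (t : Fin (n + 1) → I) (ε : Fin n → Bool) :
    D.subwordElement t (Fin.snoc ε true) =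
      D.nilOp (t (Fin.last n)) (D.subwordElement (Fin.init t) ε) := by
  simp only [subwordElement, prod_ofFn_snoc, card_filter_snoc, Bool.toNat_true, pow_one]
  have h1 := D.length_subword_le (Fin.init t) ε
  set x := (List.ofFn fun j => D.s (Fin.init t j) ^ (ε j).toNat).prod
  have h2 := D.length_mul_s x (t (Fin.last n))
  by_cases h : (Finset.univ.filter fun j => ε j = true).card = D.length x
  · rw [if_pos h]
    by_cases hl : D.length x < D.length (x * D.s (t (Fin.last n)))
    · rw [if_pos (by omega), D.nilOp_single_of_lt hl]
    · rw [if_neg (by omega), D.nilOp_single_of_not_lt hl]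
  · rw [if_neg h, map_zero, if_neg (by omega)]

theorem maskElement_succ {n : ℕ} (t : Fin (n + 1) → I) (b : Fin (n + 1) → D.RootLattice) :
    D.maskElement t b = D.maskElement (Fin.init t) (Fin.init b) +
      D.toPolynomial (b (Fin.last n)) •
        D.nilOp (t (Fin.last n)) (D.maskElement (Fin.init t) (Fin.init b)) := by
  have hprod : ∀ (ε : Fin n → Bool) (c : Bool),
      ∏ j ∈ Finset.univ.filter (fun j => (Fin.snoc ε c : Fin (n + 1) → Bool) j = true),
        D.toPolynomial (b j) =
      (∏ j ∈ Finset.univ.filter (fun j => ε j = true), D.toPolynomial (Fin.init b j)) *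
        if c = true then D.toPolynomial (b (Fin.last n)) else 1 := by
    intro ε c
    rw [Finset.prod_filter, Finset.prod_filter, Fin.prod_univ_castSucc, Fin.snoc_last]
    simp only [Fin.snoc_castSucc, Fin.init]
  rw [maskElement, ← (Fin.snocEquiv fun _ => Bool).sum_comp, Fintype.sum_prod_type,
    Fintype.sum_bool, add_comm]
  have hs : ∀ (ε : Fin n → Bool) (c : Bool),
      (Fin.snocEquiv fun _ => Bool) (c, ε) = (Fin.snoc ε c : Fin (n + 1) → Bool) := fun _ _ => rfl
  simp only [hs]
  congr 1
  · refine Finset.sum_congr rfl fun ε _ => ?_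
    rw [hprod, subwordElement_snoc_false]; simp
  · rw [maskElement, map_sum, Finset.smul_sum]
    refine Finset.sum_congr rfl fun ε _ => ?_
    rw [hprod, subwordElement_snoc_true, if_pos rfl, map_smul, smul_smul, mul_comm]

theorem maskElement_apply_one {n : ℕ} (t : Fin n → I) (b : Fin n → D.RootLattice) :
    D.maskElement t b 1 = 1 := by
  induction n with
  | zero => simp [maskElement, subwordElement, length_one]
  | succ n ih =>
    rw [maskElement_succ, Finsupp.add_apply, Finsupp.smul_apply, nilOp_apply_one, ih, smul_zero,
      add_zero]

/-- If step `j` of a walk `u_0 = 1, u_1, …` is `u_{j+1} = u_j s_{t_j}` and is indexed by the root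
`u_j α_{t_j}`, then the generating element of the mask sums is a common eigenvector of the Chevalley
operators, with the eigenvalues `w χ`, where `w` is the end of the walk. -/
theorem chevalley_maskElement {n : ℕ} (t : Fin n → I) (b : Fin n → D.RootLattice)
    (u : Fin (n + 1) → D.AffineWeylGroup) (h0 : u 0 = 1)
    (hu : ∀ j : Fin n, u j.succ = u j.castSucc * D.s (t j))
    (hb : ∀ j : Fin n, b j = D.action (u j.castSucc) (D.simpleRoot (t j))) (χ : D.RootLattice) :
    D.chevalley χ (D.maskElement t b) =
      D.toPolynomial (D.action (u (Fin.last n)) χ) • D.maskElement t b := by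
  induction n generalizing χ with
  | zero =>
    have h : D.chevalley χ (Finsupp.single 1 1) = Finsupp.single 1 (D.toPolynomial χ) := by
      have := D.chevalley_single χ (ω := []) (by simp [CoxeterSystem.IsReduced])
      rw [CoxeterSystem.wordProd_nil] at this
      rw [this]
      simp [chevalleyWord, CoxeterSystem.wordProd]
    have h1 : D.maskElement t b = Finsupp.single 1 1 := by
      simp [maskElement, subwordElement, length_one]
    rw [h1, h, show Fin.last 0 = 0 from rfl, h0, action_one]
    simp
  | succ n ih =>
    have hi := ih (Fin.init t) (Fin.init b) (fun j => u j.castSucc) h0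
      (fun j => hu j.castSucc) (fun j => hb j.castSucc)
    set m := D.maskElement (Fin.init t) (Fin.init b)
    have hl := hu (Fin.last n)
    rw [Fin.succ_last] at hl
    rw [maskElement_succ, map_add, map_smul, chevalley_nilOp, hi, hi, hb (Fin.last n), hl,
      action_mul, map_smul]
    set w := u (Fin.last n).castSucc
    set i := t (Fin.last n)
    have hχ : D.toPolynomial (D.action w χ) = D.toPolynomial (D.action w (D.action (D.s i) χ)) +
        (D.simpleCoroot i χ : MvPolynomial I ℤ) * D.toPolynomial (D.action w (D.simpleRoot i)) := by
      rw [action_s_apply, map_sub, map_smul, toPolynomial_sub, toPolynomial_zsmul]; ring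
    rw [hχ]
    module

theorem maskElement_eq {n n' : ℕ} {t : Fin n → I} {b : Fin n → D.RootLattice}
    {u : Fin (n + 1) → D.AffineWeylGroup} (h0 : u 0 = 1)
    (hu : ∀ j : Fin n, u j.succ = u j.castSucc * D.s (t j))
    (hb : ∀ j : Fin n, b j = D.action (u j.castSucc) (D.simpleRoot (t j)))
    {t' : Fin n' → I} {b' : Fin n' → D.RootLattice}
    {u' : Fin (n' + 1) → D.AffineWeylGroup} (h0' : u' 0 = 1)
    (hu' : ∀ j : Fin n', u' j.succ = u' j.castSucc * D.s (t' j))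
    (hb' : ∀ j : Fin n', b' j = D.action (u' j.castSucc) (D.simpleRoot (t' j)))
    (h : u (Fin.last n) = u' (Fin.last n')) : D.maskElement t b = D.maskElement t' b' :=
  D.eq_of_chevalley_eq (D.chevalley_maskElement t b u h0 hu hb)
    (h ▸ D.chevalley_maskElement t' b' u' h0' hu' hb')
    (D.maskElement_apply_one t b) (D.maskElement_apply_one t' b')

theorem AlcoveWalk.maskSum_eq {D : AffineCartanDatum I} (γ : D.AlcoveWalk)
    (v : D.AffineWeylGroup) : γ.maskSum v = D.maskElement γ.type γ.root v := by
  rw [maskSum, Finset.sum_filter, maskElement, Finsupp.finsetSum_apply]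
  refine Finset.sum_congr rfl fun ε _ => ?_
  rw [Finsupp.smul_apply, subwordElement, smul_eq_mul]
  change _ = γ.Psi ε * (if γ.support ε = D.length (γ.subexpression ε) then
    Finsupp.single (γ.subexpression ε) 1 else 0 : D.NilModule) v
  by_cases h : γ.subexpression ε = v
  · subst h
    by_cases h' : γ.support ε = D.length (γ.subexpression ε) <;> simp [h']
  · rw [if_neg (fun hh => h hh.2)]
    split_ifs <;> simp [h]

/-! ### Null root and coordinates on `V^*` -/

theorem form_pos {x : I → ℝ} {i : I} (hi : x i = 0) (hx : x ≠ 0) : 0 < D.form x x := by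
  have hJ : Finset.univ.erase i ≠ Finset.univ := by
    intro h
    have := Finset.mem_univ i
    rw [← h] at this
    exact Finset.notMem_erase i _ this
  have hp := D.posDef.choose_spec.2.2 _ hJ
  have hx' : (fun j : (Finset.univ.erase i : Finset I) => x j) ≠ 0 := by
    intro h
    apply hx
    ext j
    by_cases hj : j = i
    · rw [hj, hi]; rfl
    · exact congrFun h ⟨j, by simp [hj]⟩
  have h := hp.dotProduct_mulVec_pos hx'
  have hsum : ∀ g : I → ℝ, g i = 0 → ∑ j : (Finset.univ.erase i : Finset I), g j = ∑ j, g j := by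
    intro g hg
    rw [Finset.sum_coe_sort (Finset.univ.erase i) g]
    exact Finset.sum_erase _ hg
  refine h.trans_eq (Eq.symm ?_)
  simp only [form, dotProduct, Matrix.mulVec, star_trivial, Matrix.submatrix_apply,
    Matrix.diagonal_mul,
    Matrix.map_apply]
  rw [hsum (fun j => x j * ∑ k : (Finset.univ.erase i : Finset I),
    D.posDef.choose j * (D.A j k : ℝ) * x k) (by simp [hi])]
  refine Finset.sum_congr rfl fun j _ => ?_
  rw [hsum (fun k => D.posDef.choose j * (D.A j k : ℝ) * x k) (by simp [hi]), Finset.mul_sum]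
  exact Finset.sum_congr rfl fun k _ => by rw [mul_assoc, weight]

theorem form_eq_sum (x y : I → ℝ) :
    D.form x y = ∑ i, x i * D.weight i * ∑ j, (D.A i j : ℝ) * y j := by
  unfold form
  refine Finset.sum_congr rfl fun i _ => ?_
  rw [Finset.mul_sum]
  exact Finset.sum_congr rfl fun j _ => by ring

theorem form_eq_zero_of_null {x : I → ℝ} (hx : ∀ i, ∑ j, (D.A i j : ℝ) * x j = 0) (y : I → ℝ) :
    D.form y x = 0 := by
  rw [form_eq_sum]; simp [hx]

/-- The Cartan matrix has a null vector with positive entries: replacing the entries of a null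
vector by their absolute values does not increase the form, as the off-diagonal entries of the
Cartan matrix are nonpositive. -/
theorem exists_null : ∃ δ : I → ℝ, (∀ i, 0 < δ i) ∧ (∀ i, ∑ j, (D.A i j : ℝ) * δ j = 0) ∧
    δ D.zero = 1 := by
  obtain ⟨x, hx0, hx⟩ : ∃ x : I → ℝ, x ≠ 0 ∧ (D.A.map (Int.cast : ℤ → ℝ)).mulVec x = 0 := by
    rw [Matrix.exists_mulVec_eq_zero_iff]
    by_contra hdet
    have h1 := D.corank_one
    rw [Matrix.rank_of_isUnit _ ((Matrix.isUnit_iff_isUnit_det _).mpr (Ne.isUnit hdet))] at h1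
    omega
  have hxn : ∀ i, ∑ j, (D.A i j : ℝ) * x j = 0 := fun i => congrFun hx i
  have hne : ∀ i, x i ≠ 0 := by
    intro i hi
    have h1 := D.form_pos hi hx0
    rw [D.form_eq_zero_of_null hxn] at h1
    exact lt_irrefl _ h1
  set y : I → ℝ := fun i => |x i| with hy
  have hyy : D.form y y ≤ 0 := by
    rw [← D.form_eq_zero_of_null hxn x]
    refine Finset.sum_le_sum fun i _ => Finset.sum_le_sum fun j _ => ?_
    by_cases hij : i = j
    · subst hij
      rw [hy]
      have := abs_mul_abs_self (x i)
      exact le_of_eq (by linear_combination D.weight i * (D.A i i : ℝ) * this)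
    · have h1 : (D.A i j : ℝ) ≤ 0 := by exact_mod_cast D.nonpos i j hij
      have h2 := D.weight_pos i
      have h3 : x i * x j ≤ |x i| * |x j| := by rw [← abs_mul]; exact le_abs_self _
      have h4 : D.weight i * D.A i j ≤ 0 := mul_nonpos_of_nonneg_of_nonpos h2.le h1
      simp only [hy]
      nlinarith
  set c := y D.zero / x D.zero with hc
  have hz : y - c • x = 0 := by
    by_contra hz
    have h1 := D.form_pos (i := D.zero) (by
      rw [Pi.sub_apply, Pi.smul_apply, smul_eq_mul, hc, div_mul_cancel₀ _ (hne _), sub_self]) hz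
    rw [form_sub_left, form_sub_right, form_smul_left, form_smul_right, form_sub_right,
      form_smul_right, D.form_comm x y] at h1
    simp only [D.form_eq_zero_of_null hxn] at h1
    linarith
  have hyn : ∀ i, ∑ j, (D.A i j : ℝ) * y j = 0 := by
    intro i
    rw [sub_eq_zero.mp hz]
    simp only [Pi.smul_apply, smul_eq_mul]
    rw [← mul_zero c, ← hxn i, Finset.mul_sum]
    exact Finset.sum_congr rfl fun j _ => by ring
  have hypos : ∀ i, 0 < y i := fun i => abs_pos.mpr (hne i)
  refine ⟨fun i => y i / y D.zero, fun i => div_pos (hypos i) (hypos _), fun i => ?_,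
    div_self (hypos _).ne'⟩
  simp only [mul_div_assoc']
  rw [← Finset.sum_div, hyn, zero_div]

/-- The null root, normalized so that its coefficient at the distinguished index is one. Its
coordinates are real numbers. -/
noncomputable def nullRoot : I → ℝ := D.exists_null.choose

theorem nullRoot_pos (i : I) : 0 < D.nullRoot i := D.exists_null.choose_spec.1 i

theorem sum_mul_nullRoot (i : I) : ∑ j, (D.A i j : ℝ) * D.nullRoot j = 0 :=
  D.exists_null.choose_spec.2.1 i

theorem nullRoot_zero : D.nullRoot D.zero = 1 := D.exists_null.choose_spec.2.2

theorem sum_mul_simpleRoot (f : D.RootLattice →+ ℝ) (μ : D.RootLattice) :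
    f μ = ∑ i, (μ i : ℝ) * f (D.simpleRoot i) := by
  have h : μ = ∑ i, μ i • D.simpleRoot i := by
    ext j
    rw [Finset.sum_apply, Finset.sum_eq_single j]
    · simp [simpleRoot]
    · intro i _ hi
      rw [Pi.smul_apply, D.simpleRoot_apply_of_ne hi.symm, smul_zero]
    · simp
  conv_lhs => rw [h]
  rw [map_sum]
  exact Finset.sum_congr rfl fun i _ => by rw [map_zsmul, zsmul_eq_mul]

/-- The null root is invariant under the affine Weyl group. -/
theorem sum_nullRoot_mul_action (f : D.RootLattice →+ ℝ) (w : D.AffineWeylGroup) :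
    ∑ i, D.nullRoot i * f (D.action w (D.simpleRoot i)) =
      ∑ i, D.nullRoot i * f (D.simpleRoot i) := by
  induction w using D.cs.simple_induction_right with
  | one => simp only [action_one]
  | mul_simple_right w j ih =>
    rw [← ih]
    have h : ∀ i, D.nullRoot i * f (D.action (w * D.cs.simple j) (D.simpleRoot i)) =
        D.nullRoot i * f (D.action w (D.simpleRoot i)) -
          ((D.A j i : ℝ) * D.nullRoot i) * f (D.action w (D.simpleRoot j)) := by
      intro i
      rw [cs_simple, action_mul, action_s_apply, simpleCoroot_simpleRoot, map_sub, map_smul,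
        map_sub, map_zsmul, zsmul_eq_mul]
      ring
    rw [Finset.sum_congr rfl fun i _ => h i, Finset.sum_sub_distrib, ← Finset.sum_mul,
      sum_mul_nullRoot, zero_mul, sub_zero]

/-- Evaluation at a point of `V^*` of the affine functions attached to the elements of the affine
root lattice. -/
noncomputable def evalAt (v : D.V) : D.RootLattice →+ ℝ where
  toFun := D.affineValue v
  map_zero' := by simp [affineValue, pairing]
  map_add' μ ν := by
    simp only [affineValue, pairing, map_add, Int.cast_add, mul_add, Finset.sum_add_distrib,
      Pi.add_apply]
    ring

theorem evalAt_apply (v : D.V) (μ : D.RootLattice) : D.evalAt v μ = D.affineValue v μ := rfl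

theorem affineValue_eq_sum (v : D.V) (μ : D.RootLattice) (w : D.AffineWeylGroup) :
    D.affineValue v (D.action w μ) =
      ∑ i, (μ i : ℝ) * D.affineValue v (D.action w (D.simpleRoot i)) :=
  D.sum_mul_simpleRoot ((D.evalAt v).comp (D.action w).toAddMonoidHom) μ

theorem affineValue_neg (v : D.V) (μ : D.RootLattice) :
    D.affineValue v (-μ) = -D.affineValue v μ := map_neg (D.evalAt v) μ

theorem affineValue_comb (u v : D.V) (a b : ℝ) (hab : a + b = 1) (μ : D.RootLattice) :
    D.affineValue (a • u + b • v) μ = a * D.affineValue u μ + b * D.affineValue v μ := by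
  have h : D.pairing (a • u + b • v) μ = a * D.pairing u μ + b * D.pairing v μ := by
    simp only [pairing, Pi.add_apply, Pi.smul_apply, smul_eq_mul, Finset.mul_sum,
      ← Finset.sum_add_distrib]
    exact Finset.sum_congr rfl fun i _ => by ring
  rw [affineValue, h, affineValue, affineValue]
  linear_combination -(μ D.zero : ℝ) * hab

theorem continuous_affineValue (μ : D.RootLattice) :
    Continuous fun v => D.affineValue v μ := by
  unfold affineValue pairing
  fun_prop

theorem affineValue_simpleRoot (v : D.V) (i : I) :
    D.affineValue v (D.simpleRoot i) =
      ∑ j, v j * (D.A j.1 i : ℝ) + (D.simpleRoot i D.zero : ℝ) := by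
  simp only [affineValue, pairing, simpleCoroot_simpleRoot]

theorem sum_nullRoot_mul_affineValue (v : D.V) :
    ∑ i, D.nullRoot i * D.affineValue v (D.simpleRoot i) = 1 := by
  simp only [affineValue_simpleRoot, mul_add, Finset.sum_add_distrib, Finset.mul_sum]
  rw [Finset.sum_comm, Finset.sum_eq_zero, zero_add, Finset.sum_eq_single D.zero]
  · rw [simpleRoot_apply_self, nullRoot_zero]; norm_num
  · intro i _ hi
    rw [D.simpleRoot_apply_of_ne hi.symm]; norm_num
  · simp
  · intro j _
    have h : ∀ i, D.nullRoot i * (v j * (D.A j.1 i : ℝ)) =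
        v j * ((D.A j.1 i : ℝ) * D.nullRoot i) := fun i => by ring
    rw [Finset.sum_congr rfl fun i _ => h i, ← Finset.mul_sum, sum_mul_nullRoot, mul_zero]

theorem sum_nullRoot_mul_affineValue_action (v : D.V) (w : D.AffineWeylGroup) :
    ∑ i, D.nullRoot i * D.affineValue v (D.action w (D.simpleRoot i)) = 1 := by
  rw [← D.sum_nullRoot_mul_affineValue v]
  exact D.sum_nullRoot_mul_action (D.evalAt v) w

/-- The values of the simple affine roots are coordinates on `V^*`, subject to the single condition
that the null root takes the value one. -/
theorem exists_affineValue_simpleRoot (x : I → ℝ) (hx : ∑ i, D.nullRoot i * x i = 1) :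
    ∃ v, ∀ i, D.affineValue v (D.simpleRoot i) = x i := by
  let φ : D.V →ₗ[ℝ] D.V :=
    { toFun := fun v i => ∑ j, v j * (D.A j.1 i.1 : ℝ)
      map_add' := fun u v => by
        ext i; simp only [Pi.add_apply, add_mul, Finset.sum_add_distrib]
      map_smul' := fun c v => by
        ext i; simp only [Pi.smul_apply, smul_eq_mul, mul_assoc, Finset.mul_sum, RingHom.id_apply] }
  have hφ : Function.Injective φ := by
    rw [← LinearMap.ker_eq_bot, LinearMap.ker_eq_bot']
    intro v hv
    set y : I → ℝ := fun i => if h : i ≠ D.zero then v ⟨i, h⟩ / D.weight i else 0 with hy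
    have hy0 : y D.zero = 0 := by simp [hy]
    have hsub : ∀ g : I → ℝ, g D.zero = 0 → ∑ i, g i = ∑ j : {i // i ≠ D.zero}, g j := by
      intro g hg
      rw [← Finset.sum_subtype (Finset.univ.erase D.zero) (fun i => by simp) g]
      exact (Finset.sum_erase _ hg).symm
    have hyv : ∀ j : {i // i ≠ D.zero}, y j * D.weight j = v j := by
      intro j
      simp only [hy, dif_pos j.2]
      exact div_mul_cancel₀ _ (D.weight_pos _).ne'
    have hyz : y = 0 := by
      by_contra hne
      have h1 := D.form_pos hy0 hne
      rw [form, Finset.sum_comm, hsub _ (by simp [hy0]), Finset.sum_eq_zero] at h1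
      · exact lt_irrefl _ h1
      intro i _
      have h2 : ∑ j : {i // i ≠ D.zero}, v j * (D.A j.1 i.1 : ℝ) = 0 := congrFun hv i
      rw [← Finset.sum_mul, hsub _ (by simp [hy0]), ← zero_mul (y i), ← h2]
      congr 1
      exact Finset.sum_congr rfl fun j _ => by rw [← hyv]; ring
    ext j
    rw [← hyv, hyz]; simp
  obtain ⟨v, hv⟩ := LinearMap.injective_iff_surjective.mp hφ fun i => x i.1
  have h : ∀ i, i ≠ D.zero → D.affineValue v (D.simpleRoot i) = x i := by
    intro i hi
    rw [affineValue_simpleRoot, D.simpleRoot_apply_of_ne hi.symm, Int.cast_zero, add_zero]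
    exact congrFun hv ⟨i, hi⟩
  refine ⟨v, fun i => ?_⟩
  by_cases hi : i = D.zero
  · subst hi
    have h1 := D.sum_nullRoot_mul_affineValue v
    rw [← Finset.add_sum_erase _ _ (Finset.mem_univ D.zero), nullRoot_zero] at h1 hx
    rw [Finset.sum_congr rfl fun i hi => by rw [h i (Finset.ne_of_mem_erase hi)]] at h1
    linarith
  · exact h i hi

theorem exists_affineValue (w : D.AffineWeylGroup) (x : I → ℝ)
    (hx : ∑ i, D.nullRoot i * x i = 1) :
    ∃ v, ∀ i, D.affineValue v (D.action w (D.simpleRoot i)) = x i := by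
  let g : D.RootLattice →+ ℝ :=
    { toFun := fun μ => ∑ i, (μ i : ℝ) * x i
      map_zero' := by simp
      map_add' := fun μ ν => by simp [add_mul, Finset.sum_add_distrib] }
  have hg : ∀ i, g (D.simpleRoot i) = x i := by
    intro i
    change ∑ j, (D.simpleRoot i j : ℝ) * x j = x i
    rw [Finset.sum_eq_single i (fun j _ hj => by rw [D.simpleRoot_apply_of_ne hj]; simp) (by simp),
      simpleRoot_apply_self]
    simp
  let f : D.RootLattice →+ ℝ := g.comp (D.action w⁻¹).toAddMonoidHom
  have hf : ∀ i, f (D.action w (D.simpleRoot i)) = x i := by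
    intro i
    change g (D.action w⁻¹ (D.action w (D.simpleRoot i))) = x i
    rw [action_inv_action, hg]
  obtain ⟨v, hv⟩ := D.exists_affineValue_simpleRoot (fun i => f (D.simpleRoot i)) (by
    rw [← D.sum_nullRoot_mul_action f w]
    simp only [hf]
    exact hx)
  refine ⟨v, fun i => ?_⟩
  rw [← hf i, D.sum_mul_simpleRoot f, ← evalAt_apply, D.sum_mul_simpleRoot (D.evalAt v)]
  exact Finset.sum_congr rfl fun j _ => by rw [evalAt_apply, hv]

theorem eq_zero_of_sum_affineValue {y : I → ℝ}
    (h : ∀ v, ∑ i, y i * D.affineValue v (D.simpleRoot i) = 0) : y = 0 := by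
  ext i
  have hi := D.nullRoot_pos i
  obtain ⟨v, hv⟩ := D.exists_affineValue_simpleRoot (Pi.single i (D.nullRoot i)⁻¹) (by
    rw [Finset.sum_eq_single i (fun j _ hj => by simp [hj]) (by simp), Pi.single_eq_same,
      mul_inv_cancel₀ hi.ne'])
  have h1 := h v
  simp only [hv] at h1
  rw [Finset.sum_eq_single i (fun j _ hj => by simp [hj]) (by simp), Pi.single_eq_same] at h1
  simpa [hi.ne'] using h1

theorem form_root_pos {β : D.RootLattice} (h : β ∈ D.affineRoots) :
    0 < D.form (D.toReal β) (D.toReal β) := by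
  obtain ⟨w, i, rfl⟩ := h
  rw [form_action, form_simpleRoot_self]
  have := D.weight_pos i
  linarith

theorem affineValue_eq_sum_simpleRoot (v : D.V) (μ : D.RootLattice) :
    D.affineValue v μ = ∑ i, (μ i : ℝ) * D.affineValue v (D.simpleRoot i) :=
  D.sum_mul_simpleRoot (D.evalAt v) μ

/-- Roots are not constant functions on `V^*`. -/
theorem exists_affineValue_ne {β : D.RootLattice} (h : β ∈ D.affineRoots) (v₀ : D.V) :
    ∃ v, D.affineValue v β ≠ D.affineValue v₀ β := by
  by_contra! hc
  set c := D.affineValue v₀ β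
  have h1 : D.toReal β - c • D.nullRoot = 0 := by
    refine D.eq_zero_of_sum_affineValue fun v => ?_
    have h2 := hc v
    rw [affineValue_eq_sum_simpleRoot] at h2
    simp only [Pi.sub_apply, Pi.smul_apply, smul_eq_mul, sub_mul, Finset.sum_sub_distrib, mul_assoc]
    rw [← Finset.mul_sum, sum_nullRoot_mul_affineValue, mul_one]
    exact sub_eq_zero.mpr h2
  have h2 := D.form_root_pos h
  nth_rw 2 [sub_eq_zero.mp h1] at h2
  rw [form_smul_right, D.form_eq_zero_of_null D.sum_mul_nullRoot, mul_zero] at h2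
  exact lt_irrefl _ h2

theorem eq_or_neg_of_smul_eq {β β' : D.RootLattice} (h : β ∈ D.affineRoots)
    (h' : β' ∈ D.affineRoots) {a b : ℤ} (ha : a ≠ 0) (e : a • β' = b • β) :
    β' = β ∨ β' = -β := by
  obtain ⟨w, i, rfl⟩ := h
  have e1 := congrArg (D.action w⁻¹) e
  rw [map_smul, map_smul, action_inv_action] at e1
  have hs : ∀ j, j ≠ i → D.action w⁻¹ β' j = 0 := by
    intro j hj
    have := congrFun e1 j
    simpa [simpleRoot, hj, ha] using this
  rcases D.eq_simpleRoot_of_support (D.action_mem_affineRoots _ h') hs with e2 | e2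
  · left; rw [← e2, action_action_inv]
  · right; rw [← map_neg, ← e2, action_action_inv]

/-- Distinct hyperplanes are not contained in each other, and a hyperplane determines its root up to
the sign. -/
theorem eq_or_neg_of_hyperplane_subset {β β' : D.RootLattice} (h : β ∈ D.affineRoots)
    (h' : β' ∈ D.affineRoots) (hsub : D.hyperplane β ⊆ D.hyperplane β') :
    β' = β ∨ β' = -β := by
  obtain ⟨p, hp⟩ := D.exists_affineValue_ne h 0
  set b0 := D.affineValue 0 β
  set b1 := D.affineValue p β
  set c0 := D.affineValue 0 β'
  set c1 := D.affineValue p β'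
  have hb : b1 - b0 ≠ 0 := sub_ne_zero.mpr hp
  -- shift a point `v` in the direction of `p` until it lies on the hyperplane of `β`
  have key : ∀ v, D.affineValue v β' = (c1 - c0) / (b1 - b0) * D.affineValue v β := by
    intro v
    set r := D.affineValue v β / (b1 - b0) with hr
    have hval : ∀ μ, D.affineValue (v - r • (p - 0)) μ =
        D.affineValue v μ - r * (D.affineValue p μ - D.affineValue 0 μ) := by
      intro μ
      simp only [affineValue, pairing, sub_zero, Pi.sub_apply, Pi.smul_apply, smul_eq_mul,
        Pi.zero_apply, zero_mul, Finset.sum_const_zero, zero_add, sub_mul, Finset.sum_sub_distrib,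
        mul_assoc, ← Finset.mul_sum]
      ring
    have h1 : v - r • (p - 0) ∈ D.hyperplane β := by
      change D.affineValue _ β = 0
      rw [hval, hr]
      field_simp
      ring
    have h2 : D.affineValue (v - r • (p - 0)) β' = 0 := hsub h1
    rw [hval] at h2
    rw [sub_eq_zero.mp h2, hr]
    field_simp
    ring
  set c := (c1 - c0) / (b1 - b0)
  have hc : D.toReal β' - c • D.toReal β = 0 := by
    refine D.eq_zero_of_sum_affineValue fun v => ?_
    have h2 := key v
    rw [affineValue_eq_sum_simpleRoot, D.affineValue_eq_sum_simpleRoot v β] at h2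
    simp only [Pi.sub_apply, Pi.smul_apply, smul_eq_mul, sub_mul, Finset.sum_sub_distrib, mul_assoc]
    rw [← Finset.mul_sum]
    exact sub_eq_zero.mpr h2
  have hc' : ∀ i, (β' i : ℝ) = c * β i := fun i => congrFun (sub_eq_zero.mp hc) i
  obtain ⟨j, hj⟩ := Function.ne_iff.mp (D.affineRoots_ne_zero h)
  refine D.eq_or_neg_of_smul_eq h h' (a := β j) (b := β' j) hj ?_
  ext i
  have : (β j : ℝ) * β' i = β' j * β i := by rw [hc' i, hc' j]; ring
  simpa using (by exact_mod_cast this : β j * β' i = β' j * β i)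

/-! ### Alcoves -/

theorem simpleRoot_mem_positiveRoots (i : I) : D.simpleRoot i ∈ D.positiveRoots :=
  ⟨⟨1, i, by rw [action_one]⟩, D.simpleRoot_nonneg i⟩

/-- The alcove `w a_0` is cut out by the finitely many inequalities `w α_i ≥ 0`. -/
theorem mem_alcove_iff {w : D.AffineWeylGroup} {v : D.V} :
    v ∈ D.alcove w ↔ ∀ i, 0 ≤ D.affineValue v (D.action w (D.simpleRoot i)) := by
  constructor
  · rintro ⟨u, hu, h⟩ i
    rw [h]
    exact hu _ (D.simpleRoot_mem_positiveRoots i)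
  · intro h
    obtain ⟨u, hu⟩ := D.exists_affineValue_simpleRoot _ (D.sum_nullRoot_mul_affineValue_action v w)
    refine ⟨u, fun β hβ => ?_, fun μ => ?_⟩
    · rw [affineValue_eq_sum_simpleRoot]
      refine Finset.sum_nonneg fun i _ => mul_nonneg (by exact_mod_cast hβ.2 i) ?_
      rw [hu]; exact h i
    · rw [affineValue_eq_sum, affineValue_eq_sum_simpleRoot]
      exact Finset.sum_congr rfl fun i _ => by rw [hu]

theorem alcove_one : D.alcove 1 = D.baseAlcove := by
  ext v
  rw [mem_alcove_iff]
  simp only [action_one]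
  refine ⟨fun h β hβ => ?_, fun h i => h _ (D.simpleRoot_mem_positiveRoots i)⟩
  rw [affineValue_eq_sum_simpleRoot]
  exact Finset.sum_nonneg fun i _ => mul_nonneg (by exact_mod_cast hβ.2 i) (h i)

/-- The open alcove with closure `w a_0`. -/
def openAlcove (w : D.AffineWeylGroup) : Set D.V :=
  {v | ∀ i, 0 < D.affineValue v (D.action w (D.simpleRoot i))}

theorem openAlcove_subset_alcove (w : D.AffineWeylGroup) : D.openAlcove w ⊆ D.alcove w :=
  fun _ hv => D.mem_alcove_iff.mpr fun i => (hv i).le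

theorem affineValue_pos_of_mem_openAlcove {w : D.AffineWeylGroup} {v : D.V}
    (hv : v ∈ D.openAlcove w) {β : D.RootLattice} (hβ : 0 ≤ β) (h0 : β ≠ 0) :
    0 < D.affineValue v (D.action w β) := by
  obtain ⟨j, hj⟩ := Function.ne_iff.mp h0
  rw [affineValue_eq_sum]
  have hpos : 0 < β j := lt_of_le_of_ne (hβ j) (Ne.symm hj)
  exact Finset.sum_pos' (fun i _ => mul_nonneg (by exact_mod_cast hβ i) (hv i).le)
    ⟨j, Finset.mem_univ j, mul_pos (by exact_mod_cast hpos) (hv j)⟩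

theorem openAlcove_subset_complement (w : D.AffineWeylGroup) :
    D.openAlcove w ⊆ D.hyperplaneComplement := by
  intro v hv β hβ h
  have h' : D.affineValue v β = 0 := h
  have hm := D.action_mem_affineRoots w⁻¹ hβ
  have h1 : D.affineValue v (D.action w (D.action w⁻¹ β)) = 0 := by rwa [action_action_inv]
  rcases D.nonneg_or_nonpos hm with hp | hn
  · exact (D.affineValue_pos_of_mem_openAlcove hv hp (D.affineRoots_ne_zero hm)).ne' h1
  · have := D.affineValue_pos_of_mem_openAlcove hv (neg_nonneg.mpr hn)
      (neg_ne_zero.mpr (D.affineRoots_ne_zero hm))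
    rw [map_neg, affineValue_neg, h1, neg_zero] at this
    exact lt_irrefl _ this

theorem isOpen_openAlcove (w : D.AffineWeylGroup) : IsOpen (D.openAlcove w) := by
  have : D.openAlcove w = ⋂ i, {v | 0 < D.affineValue v (D.action w (D.simpleRoot i))} := by
    ext v; simp [openAlcove]
  rw [this]
  exact isOpen_iInter_of_finite fun i => isOpen_lt continuous_const (D.continuous_affineValue _)

theorem isClosed_alcove (w : D.AffineWeylGroup) : IsClosed (D.alcove w) := by
  have : D.alcove w = ⋂ i, {v | 0 ≤ D.affineValue v (D.action w (D.simpleRoot i))} := by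
    ext v; simp [mem_alcove_iff]
  rw [this]
  exact isClosed_iInter fun i => isClosed_le continuous_const (D.continuous_affineValue _)

theorem convex_openAlcove (w : D.AffineWeylGroup) : Convex ℝ (D.openAlcove w) := by
  intro u hu v hv a b ha hb hab i
  rw [D.affineValue_comb _ _ _ _ hab]
  rcases ha.eq_or_lt with rfl | ha
  · rw [zero_add] at hab; subst hab
    simpa using hv i
  · exact add_pos_of_pos_of_nonneg (mul_pos ha (hu i)) (mul_nonneg hb (hv i).le)

theorem openAlcove_nonempty (w : D.AffineWeylGroup) : (D.openAlcove w).Nonempty := by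
  have hpos : 0 < ∑ i, D.nullRoot i :=
    Finset.sum_pos (fun i _ => D.nullRoot_pos i) ⟨D.zero, Finset.mem_univ _⟩
  obtain ⟨v, hv⟩ := D.exists_affineValue w (fun _ => (∑ i, D.nullRoot i)⁻¹) (by
    rw [← Finset.sum_mul, mul_inv_cancel₀ hpos.ne'])
  exact ⟨v, fun i => by rw [hv]; exact inv_pos.mpr hpos⟩

theorem closure_openAlcove (w : D.AffineWeylGroup) : closure (D.openAlcove w) = D.alcove w := by
  refine Set.Subset.antisymm
    (closure_minimal (D.openAlcove_subset_alcove w) (D.isClosed_alcove w)) fun v hv => ?_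
  obtain ⟨p, hp⟩ := D.openAlcove_nonempty w
  have h1 : openSegment ℝ v p ⊆ D.openAlcove w := by
    rintro _ ⟨a, b, ha, hb, hab, rfl⟩ i
    rw [D.affineValue_comb _ _ _ _ hab]
    exact add_pos_of_nonneg_of_pos (mul_nonneg ha.le (D.mem_alcove_iff.mp hv i))
      (mul_pos hb (hp i))
  have h2 := closure_mono h1
  rw [closure_openSegment] at h2
  exact h2 (left_mem_segment ℝ v p)

/-- An open alcove meets no other alcove. -/
theorem eq_of_mem_openAlcove {w w' : D.AffineWeylGroup} {v : D.V} (h : v ∈ D.openAlcove w)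
    (h' : v ∈ D.alcove w') : w = w' := by
  by_contra hne
  have hy : w⁻¹ * w' ≠ 1 := fun h => hne (inv_mul_eq_one.mp h)
  obtain ⟨k, hk⟩ := D.exists_descent hy
  have h1 := D.affineValue_pos_of_mem_openAlcove h (neg_nonneg.mpr (D.action_simpleRoot_nonpos hk))
    (neg_ne_zero.mpr (D.affineRoots_ne_zero (D.action_simpleRoot_mem _ k)))
  rw [map_neg, affineValue_neg, ← action_mul, mul_inv_cancel_left] at h1
  have h2 := D.mem_alcove_iff.mp h' k
  linarith

theorem alcove_injective : Function.Injective D.alcove := by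
  intro w w' h
  obtain ⟨v, hv⟩ := D.openAlcove_nonempty w
  exact D.eq_of_mem_openAlcove hv (h ▸ D.openAlcove_subset_alcove w hv)

/-- The form is bounded below on the hyperplane `y_0 = 0`, by compactness of the unit sphere. -/
theorem exists_form_ge : ∃ c > 0, ∀ y : I → ℝ, y D.zero = 0 → c * ‖y‖ ^ 2 ≤ D.form y y := by
  have hcont : Continuous fun y : I → ℝ => D.form y y := by
    unfold form
    fun_prop
  set S : Set (I → ℝ) := Metric.sphere 0 1 ∩ {y | y D.zero = 0} with hS
  have hc : IsCompact S := (isCompact_sphere 0 1).inter_right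
    (isClosed_eq (continuous_apply D.zero) continuous_const)
  obtain ⟨c, hc0, hcS⟩ : ∃ c > 0, ∀ y ∈ S, c ≤ D.form y y := by
    rcases S.eq_empty_or_nonempty with he | hne
    · exact ⟨1, one_pos, fun y hy => by rw [he] at hy; exact hy.elim⟩
    · obtain ⟨y, hy, hmin⟩ := hc.exists_isMinOn hne hcont.continuousOn
      refine ⟨D.form y y, D.form_pos hy.2 ?_, fun z hz => hmin hz⟩
      rintro rfl
      have := hy.1
      simp at this
  refine ⟨c, hc0, fun y hy => ?_⟩
  by_cases h0 : y = 0
  · subst h0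
    simp [form]
  have hn : ‖y‖ ≠ 0 := norm_ne_zero_iff.mpr h0
  have h1 := hcS (‖y‖⁻¹ • y) ⟨by
    rw [mem_sphere_zero_iff_norm, norm_smul, norm_inv, norm_norm, inv_mul_cancel₀ hn], by
    simp [hy]⟩
  rw [form_smul_left, form_smul_right, ← mul_assoc, ← mul_inv, ← sq,
    inv_mul_eq_div, le_div_iff₀ (by positivity)] at h1
  exact h1

/-- Modulo the null root, the affine roots are bounded. -/
theorem exists_root_bound : ∃ K : ℝ, ∀ β ∈ D.affineRoots, ∀ i,
    |(β i : ℝ) - β D.zero * D.nullRoot i| ≤ K := by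
  obtain ⟨c, hc, hform⟩ := D.exists_form_ge
  set C := ∑ i, 2 * D.weight i
  refine ⟨C / c + 1, fun β hβ i => ?_⟩
  set y : I → ℝ := D.toReal β - (β D.zero : ℝ) • D.nullRoot with hy
  have h0 : y D.zero = 0 := by simp [hy, toReal, nullRoot_zero]
  have h1 : D.form y y ≤ C := by
    have hn := D.form_eq_zero_of_null D.sum_mul_nullRoot
    rw [hy, form_sub_left, form_sub_right, form_smul_left, form_smul_right, hn,
      D.form_comm D.nullRoot, hn]
    obtain ⟨w, k, rfl⟩ := hβ
    rw [form_action, form_simpleRoot_self, mul_zero, sub_zero, sub_zero]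
    exact Finset.single_le_sum (f := fun i => 2 * D.weight i)
      (fun i _ => by have := D.weight_pos i; positivity) (Finset.mem_univ k)
  have h2 : ‖y‖ ^ 2 ≤ C / c := by
    rw [le_div_iff₀ hc, mul_comm]
    exact (hform y h0).trans h1
  have h3 : |y i| ≤ ‖y‖ := norm_le_pi_norm y i
  change |y i| ≤ _
  nlinarith [sq_nonneg (‖y‖ - 1)]

theorem finite_negative_positiveRoots (v : D.V) (w : D.AffineWeylGroup) :
    {β | β ∈ D.positiveRoots ∧ D.affineValue v (D.action w β) < 0}.Finite := by
  obtain ⟨K, hK⟩ := D.exists_root_bound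
  set x : I → ℝ := fun i => D.affineValue v (D.action w (D.simpleRoot i)) with hx
  set B : ℝ := K + (∑ i, K * |x i|) * ∑ i, D.nullRoot i with hB
  refine (Set.finite_Icc (fun _ : I => (0 : ℤ)) fun _ => ⌈B⌉).subset fun β hβ => ?_
  obtain ⟨⟨hβ, hpos⟩, hneg⟩ := hβ
  refine Set.mem_Icc.mpr ⟨hpos, fun i => ?_⟩
  rw [affineValue_eq_sum] at hneg
  change ∑ i, (β i : ℝ) * x i < 0 at hneg
  -- the value at `β` is `β_0` up to a bounded error, so that `β_0` is bounded
  have h1 : (β D.zero : ℝ) ≤ ∑ i, K * |x i| := by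
    have h2 : ∑ i, (β i : ℝ) * x i =
        ∑ i, ((β i : ℝ) - β D.zero * D.nullRoot i) * x i + β D.zero := by
      simp only [sub_mul, Finset.sum_sub_distrib, mul_assoc]
      rw [← Finset.mul_sum, D.sum_nullRoot_mul_affineValue_action v w]
      ring
    have h3 : -∑ i, K * |x i| ≤ ∑ i, ((β i : ℝ) - β D.zero * D.nullRoot i) * x i := by
      rw [← Finset.sum_neg_distrib]
      refine Finset.sum_le_sum fun i _ => ?_
      refine le_trans (neg_le_neg ?_) (neg_abs_le _)
      rw [abs_mul]
      exact mul_le_mul_of_nonneg_right (hK β hβ i) (abs_nonneg _)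
    linarith
  have h4 : D.nullRoot i ≤ ∑ i, D.nullRoot i :=
    Finset.single_le_sum (fun i _ => (D.nullRoot_pos i).le) (Finset.mem_univ i)
  have h5 : (0 : ℝ) ≤ β D.zero := by exact_mod_cast hpos D.zero
  have h6 := (abs_le.mp (hK β hβ i)).2
  have h7 : (β D.zero : ℝ) * D.nullRoot i ≤ (∑ i, K * |x i|) * ∑ i, D.nullRoot i :=
    mul_le_mul h1 h4 (D.nullRoot_pos i).le (h5.trans h1)
  have h8 : (β i : ℝ) ≤ ⌈B⌉ := le_trans (by rw [hB]; linarith) (Int.le_ceil B)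
  exact_mod_cast h8

/-- The alcoves `w a_0` cover `V^*`: as long as some `w α_i` is negative at the given point, passing
from `w` to `w s_i` reduces the number of positive roots `β` for which `w β` is negative there. -/
theorem exists_mem_alcove (v : D.V) : ∃ w, v ∈ D.alcove w := by
  suffices H : ∀ n w, {β | β ∈ D.positiveRoots ∧ D.affineValue v (D.action w β) < 0}.ncard = n →
      ∃ w, v ∈ D.alcove w from H _ 1 rfl
  intro n
  induction n using Nat.strong_induction_on with
  | _ n ih =>
  intro w hn
  by_cases hw : v ∈ D.alcove w
  · exact ⟨w, hw⟩
  rw [mem_alcove_iff] at hw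
  push Not at hw
  obtain ⟨i, hi⟩ := hw
  refine ih _ ?_ (w * D.s i) rfl
  rw [← hn]
  have hfin := D.finite_negative_positiveRoots v w
  have hmem : D.simpleRoot i ∈
      {β | β ∈ D.positiveRoots ∧ D.affineValue v (D.action w β) < 0} :=
    ⟨D.simpleRoot_mem_positiveRoots i, hi⟩
  refine lt_of_le_of_lt (Set.ncard_le_ncard_of_injOn (D.action (D.s i)) ?_ ?_
    (hfin.subset Set.sdiff_subset)) (Set.ncard_sdiff_singleton_lt_of_mem hmem hfin)
  · rintro β ⟨⟨hβ, hpos⟩, hneg⟩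
    have hne : β ≠ D.simpleRoot i := by
      rintro rfl
      rw [action_mul_s_simpleRoot, affineValue_neg] at hneg
      linarith
    rw [action_mul] at hneg
    refine ⟨⟨⟨D.action_mem_affineRoots _ hβ, D.action_s_nonneg hβ hpos hne⟩, hneg⟩, fun h => ?_⟩
    have h1 : D.action (D.s i) (D.action (D.s i) β) = -D.simpleRoot i := by
      rw [Set.mem_singleton_iff.mp h, action_s_simpleRoot_self]
    rw [← action_mul, s_mul_s, action_one] at h1
    have := hpos i
    rw [h1] at this
    simp [simpleRoot] at this
  · intro β _ β' _ h
    have := congrArg (D.action (D.s i)) h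
    rwa [← action_mul, ← action_mul, s_mul_s, action_one, action_one] at this

theorem exists_mem_openAlcove {v : D.V} (hv : v ∈ D.hyperplaneComplement) :
    ∃ w, v ∈ D.openAlcove w := by
  obtain ⟨w, hw⟩ := D.exists_mem_alcove v
  exact ⟨w, fun i => lt_of_le_of_ne (D.mem_alcove_iff.mp hw i)
    fun h => hv _ (D.action_simpleRoot_mem w i) h.symm⟩

theorem connectedComponentIn_eq {w : D.AffineWeylGroup} {v : D.V} (hv : v ∈ D.openAlcove w) :
    connectedComponentIn D.hyperplaneComplement v = D.openAlcove w := by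
  refine Set.Subset.antisymm ?_ ((D.convex_openAlcove w).isPreconnected.subset_connectedComponentIn
    hv (D.openAlcove_subset_complement w))
  refine IsPreconnected.subset_left_of_subset_union (D.isOpen_openAlcove w)
    (v := ⋃ w' ∈ {w' | w' ≠ w}, D.openAlcove w')
    (isOpen_biUnion fun w' _ => D.isOpen_openAlcove w') ?_ ?_ ?_ isPreconnected_connectedComponentIn
  · rw [Set.disjoint_left]
    intro u hu hu'
    obtain ⟨w', hne, hw'⟩ := Set.mem_iUnion₂.mp hu'
    exact hne (D.eq_of_mem_openAlcove hu (D.openAlcove_subset_alcove w' hw')).symm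
  · intro u hu
    obtain ⟨w', hw'⟩ := D.exists_mem_openAlcove (connectedComponentIn_subset _ _ hu)
    by_cases h : w' = w
    · exact Or.inl (h ▸ hw')
    · exact Or.inr (Set.mem_iUnion₂.mpr ⟨w', h, hw'⟩)
  · exact ⟨v, mem_connectedComponentIn (D.openAlcove_subset_complement w hv), hv⟩

/-- The alcoves are the sets `w a_0`. -/
theorem isAlcove_iff {a : Set D.V} : D.IsAlcove a ↔ ∃ w, a = D.alcove w := by
  constructor
  · rintro ⟨v, hv, rfl⟩
    obtain ⟨w, hw⟩ := D.exists_mem_openAlcove hv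
    exact ⟨w, by rw [D.connectedComponentIn_eq hw, closure_openAlcove]⟩
  · rintro ⟨w, rfl⟩
    obtain ⟨v, hv⟩ := D.openAlcove_nonempty w
    exact ⟨v, D.openAlcove_subset_complement w hv,
      by rw [D.connectedComponentIn_eq hv, closure_openAlcove]⟩

/-! ### Panels -/

theorem affineSpan_subset_hyperplane {F : Set D.V} {μ : D.RootLattice}
    (h : F ⊆ D.hyperplane μ) : (affineSpan ℝ F : Set D.V) ⊆ D.hyperplane μ := by
  let H : AffineSubspace ℝ D.V :=
    { carrier := D.hyperplane μ
      smul_vsub_vadd_mem' := fun c p q r hp hq hr => by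
        have hp : D.affineValue p μ = 0 := hp
        have hq : D.affineValue q μ = 0 := hq
        have hr : D.affineValue r μ = 0 := hr
        have e : c • (p -ᵥ q) +ᵥ r = (2 : ℝ) • (((1 : ℝ) / 2) • r + ((1 : ℝ) / 2) • (c • p +
            (1 - c) • q)) + (-1 : ℝ) • q := by
          rw [vsub_eq_sub, vadd_eq_add]
          module
        change D.affineValue (c • (p -ᵥ q) +ᵥ r) μ = 0
        rw [e, D.affineValue_comb _ _ _ _ (by norm_num), D.affineValue_comb _ _ _ _ (by norm_num),
          D.affineValue_comb _ _ _ _ (by ring), hp, hq, hr]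
        ring }
  exact (affineSpan_le (Q := H)).mpr h

theorem eq_of_simpleRoot_eq_or_neg {w : D.AffineWeylGroup} {i k : I}
    (h : D.action w (D.simpleRoot k) = D.action w (D.simpleRoot i) ∨
      D.action w (D.simpleRoot k) = -D.action w (D.simpleRoot i)) : k = i := by
  have hinj : Function.Injective (D.action w) := fun μ ν e => by
    have := congrArg (D.action w⁻¹) e
    rwa [action_inv_action, action_inv_action] at this
  rcases h with h | h
  · exact D.simpleRoot_injective (hinj h)
  · rw [← map_neg] at h
    have := hinj h
    by_contra hne
    have h1 := congrFun this k
    simp [simpleRoot, hne] at h1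

/-- Every panel of `w a_0` spans one of the hyperplanes of the roots `w α_i`. -/
theorem IsPanel.exists_wall {D : AffineCartanDatum I} {w : D.AffineWeylGroup} {F : Set D.V}
    (h : D.IsPanel (D.alcove w) F) :
    ∃ i, F = D.alcove w ∩ D.hyperplane (D.action w (D.simpleRoot i)) ∧
      (affineSpan ℝ F : Set D.V) = D.hyperplane (D.action w (D.simpleRoot i)) := by
  obtain ⟨β, hβ, hF, hspan⟩ := h
  have hneg : ∀ μ, D.hyperplane (-μ) = D.hyperplane μ := by
    intro μ; ext v; simp [hyperplane, affineValue_neg]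
  have hm := D.action_mem_affineRoots w⁻¹ hβ
  obtain ⟨γ, hγ, hγ0, hγβ⟩ : ∃ γ ∈ D.affineRoots, 0 ≤ γ ∧
      D.hyperplane (D.action w γ) = D.hyperplane β := by
    rcases D.nonneg_or_nonpos hm with h | h
    · exact ⟨_, hm, h, by rw [action_action_inv]⟩
    · exact ⟨_, D.neg_mem_affineRoots hm, neg_nonneg.mpr h,
        by rw [map_neg, action_action_inv, hneg]⟩
  obtain ⟨i, hi⟩ := Function.ne_iff.mp (D.affineRoots_ne_zero hγ)
  have hi' : γ i ≠ 0 := hi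
  have hsub : F ⊆ D.hyperplane (D.action w (D.simpleRoot i)) := by
    intro v hv
    rw [hF, ← hγβ] at hv
    have h1 : D.affineValue v (D.action w γ) = 0 := hv.2
    rw [affineValue_eq_sum, Finset.sum_eq_zero_iff_of_nonneg fun k _ =>
      mul_nonneg (by exact_mod_cast hγ0 k) (D.mem_alcove_iff.mp hv.1 k)] at h1
    exact (mul_eq_zero.mp (h1 i (Finset.mem_univ i))).resolve_left (by exact_mod_cast hi')
  have hsub' := D.affineSpan_subset_hyperplane hsub
  rw [hspan] at hsub'
  have he : D.hyperplane (D.action w (D.simpleRoot i)) = D.hyperplane β := by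
    rcases D.eq_or_neg_of_hyperplane_subset hβ (D.action_simpleRoot_mem w i) hsub' with h | h
    · rw [h]
    · rw [h, hneg]
  exact ⟨i, by rw [he, hF], by rw [he, hspan]⟩

theorem exists_index_ne (D : AffineCartanDatum I) (i : I) : ∃ k, k ≠ i := by
  by_contra! h
  have h1 := D.sum_mul_nullRoot i
  rw [Finset.sum_eq_single i (fun j _ hj => (hj (h j)).elim) (by simp), D.diag] at h1
  have := D.nullRoot_pos i
  norm_num at h1
  linarith

/-- A point in the relative interior of a panel of `w a_0`. -/
theorem exists_panel_point (w : D.AffineWeylGroup) (i : I) :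
    ∃ p, ∃ c > 0, D.affineValue p (D.action w (D.simpleRoot i)) = 0 ∧
      ∀ k, k ≠ i → D.affineValue p (D.action w (D.simpleRoot k)) = c := by
  obtain ⟨k, hk⟩ := D.exists_index_ne i
  have hpos : 0 < ∑ j ∈ Finset.univ.erase i, D.nullRoot j :=
    Finset.sum_pos (fun j _ => D.nullRoot_pos j) ⟨k, by simp [hk]⟩
  set c := (∑ j ∈ Finset.univ.erase i, D.nullRoot j)⁻¹ with hc
  obtain ⟨p, hp⟩ := D.exists_affineValue w (fun j => if j = i then 0 else c) (by
    rw [← Finset.add_sum_erase _ _ (Finset.mem_univ i), if_pos rfl, mul_zero, zero_add,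
      Finset.sum_congr rfl fun j hj => by rw [if_neg (Finset.ne_of_mem_erase hj)],
      ← Finset.sum_mul, hc, mul_inv_cancel₀ hpos.ne'])
  exact ⟨p, c, inv_pos.mpr hpos, by rw [hp, if_pos rfl], fun k hk => by rw [hp, if_neg hk]⟩

/-- The intersection of `w a_0` with the hyperplane of `w α_i` spans this hyperplane. -/
theorem affineSpan_wall (w : D.AffineWeylGroup) (i : I) :
    (affineSpan ℝ (D.alcove w ∩ D.hyperplane (D.action w (D.simpleRoot i))) : Set D.V) =
      D.hyperplane (D.action w (D.simpleRoot i)) := by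
  refine Set.Subset.antisymm (D.affineSpan_subset_hyperplane Set.inter_subset_right) fun q hq => ?_
  obtain ⟨p, c, hc, hpi, hpk⟩ := D.exists_panel_point w i
  have hp : p ∈ D.alcove w ∩ D.hyperplane (D.action w (D.simpleRoot i)) := by
    refine ⟨D.mem_alcove_iff.mpr fun k => ?_, hpi⟩
    by_cases hk : k = i
    · rw [hk, hpi]
    · rw [hpk k hk]; exact hc.le
  have hqi : D.affineValue q (D.action w (D.simpleRoot i)) = 0 := hq
  -- a point close to `p` on the segment from `p` to `q`
  obtain ⟨Q, hQ0, hQ⟩ : ∃ Q ≥ 0, ∀ k, |D.affineValue q (D.action w (D.simpleRoot k))| ≤ Q :=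
    ⟨∑ k, |D.affineValue q (D.action w (D.simpleRoot k))|,
      Finset.sum_nonneg fun k _ => abs_nonneg _, fun k =>
      Finset.single_le_sum (f := fun k => |D.affineValue q (D.action w (D.simpleRoot k))|)
        (fun k _ => abs_nonneg _) (Finset.mem_univ k)⟩
  have hcQ : 0 < c + Q := add_pos_of_pos_of_nonneg hc hQ0
  obtain ⟨e, he0, he⟩ : ∃ e > 0, e * (c + Q) = c :=
    ⟨c / (c + Q), div_pos hc hcQ, div_mul_cancel₀ c hcQ.ne'⟩
  have hr : (1 - e) • p + e • q ∈ D.alcove w ∩ D.hyperplane (D.action w (D.simpleRoot i)) := by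
    refine ⟨D.mem_alcove_iff.mpr fun k => ?_, ?_⟩
    · rw [D.affineValue_comb _ _ _ _ (by ring)]
      by_cases hk : k = i
      · rw [hk, hpi, hqi]; simp
      · rw [hpk k hk]
        have h1 := hQ k
        have h2 := neg_abs_le (D.affineValue q (D.action w (D.simpleRoot k)))
        nlinarith
    · change D.affineValue _ _ = 0
      rw [D.affineValue_comb _ _ _ _ (by ring), hpi, hqi]; simp
  have hline := AffineMap.lineMap_mem (e⁻¹) (subset_affineSpan ℝ _ hp) (subset_affineSpan ℝ _ hr)
  have heq : AffineMap.lineMap p ((1 - e) • p + e • q) e⁻¹ = q := by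
    rw [AffineMap.lineMap_apply, vsub_eq_sub, vadd_eq_add,
      show (1 - e) • p + e • q - p = e • (q - p) by module, smul_smul, inv_mul_cancel₀ he0.ne']
    module
  rwa [heq] at hline

theorem affineValue_action_mul_s (v : D.V) (w : D.AffineWeylGroup) (i j : I) :
    D.affineValue v (D.action (w * D.s i) (D.simpleRoot j)) =
      D.affineValue v (D.action w (D.simpleRoot j)) -
        D.A i j * D.affineValue v (D.action w (D.simpleRoot i)) := by
  rw [action_mul, action_s_apply, simpleCoroot_simpleRoot, map_sub, map_smul]
  simp only [← evalAt_apply]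
  rw [map_sub, map_zsmul, zsmul_eq_mul]

theorem isPanel_left (w : D.AffineWeylGroup) (i : I) :
    D.IsPanel (D.alcove w) (D.alcove w ∩ D.hyperplane (D.action w (D.simpleRoot i))) :=
  ⟨_, D.action_simpleRoot_mem w i, rfl, D.affineSpan_wall w i⟩

theorem isPanel_right (w : D.AffineWeylGroup) (i : I) :
    D.IsPanel (D.alcove (w * D.s i))
      (D.alcove w ∩ D.hyperplane (D.action w (D.simpleRoot i))) := by
  refine ⟨_, D.action_simpleRoot_mem w i, ?_, D.affineSpan_wall w i⟩
  ext v
  refine and_congr_left fun hv => ?_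
  have hv : D.affineValue v (D.action w (D.simpleRoot i)) = 0 := hv
  rw [mem_alcove_iff, mem_alcove_iff]
  refine forall_congr' fun j => ?_
  rw [affineValue_action_mul_s, hv, mul_zero, sub_zero]

/-- Two distinct alcoves that share a panel are of the form `w a_0` and `w s_i a_0`, and the panel
lies on the hyperplane of `w α_i`. -/
theorem exists_eq_mul_s {w w' : D.AffineWeylGroup} (hne : w ≠ w') {F : Set D.V}
    (h : D.IsPanel (D.alcove w) F) (h' : D.IsPanel (D.alcove w') F) :
    ∃ i, w' = w * D.s i ∧ F = D.alcove w ∩ D.hyperplane (D.action w (D.simpleRoot i)) ∧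
      (affineSpan ℝ F : Set D.V) = D.hyperplane (D.action w (D.simpleRoot i)) := by
  obtain ⟨i, hF, hspan⟩ := h.exists_wall
  refine ⟨i, ?_, hF, hspan⟩
  obtain ⟨p, c, hc, hpi, hpk⟩ := D.exists_panel_point w i
  have hpF : p ∈ F := by
    rw [hF]
    refine ⟨D.mem_alcove_iff.mpr fun k => ?_, hpi⟩
    by_cases hk : k = i
    · rw [hk, hpi]
    · rw [hpk k hk]; exact hc.le
  obtain ⟨β', -, hF', -⟩ := h'
  have hp' : p ∈ D.alcove w' := by rw [hF'] at hpF; exact hpF.1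
  -- the only positive root vanishing at `w⁻¹ p` is `α_i`
  have key : ∀ y, y ≠ 1 → p ∈ D.alcove (w * y) →
      ∃ k, D.action y (D.simpleRoot k) = -D.simpleRoot i := by
    intro y hy hpy
    obtain ⟨k, hk⟩ := D.exists_descent hy
    have hnonpos := D.action_simpleRoot_nonpos hk
    have hmem := D.action_simpleRoot_mem y k
    have h1 := D.mem_alcove_iff.mp hpy k
    rw [action_mul, affineValue_eq_sum] at h1
    have hterm : ∀ j ∈ Finset.univ, (D.action y (D.simpleRoot k) j : ℝ) *
        D.affineValue p (D.action w (D.simpleRoot j)) ≤ 0 := by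
      intro j _
      refine mul_nonpos_of_nonpos_of_nonneg (by exact_mod_cast hnonpos j) ?_
      by_cases hj : j = i
      · rw [hj, hpi]
      · rw [hpk j hj]; exact hc.le
    have h2 := (Finset.sum_eq_zero_iff_of_nonpos hterm).mp
      (le_antisymm (Finset.sum_nonpos hterm) h1)
    have hs : ∀ j, j ≠ i → D.action y (D.simpleRoot k) j = 0 := by
      intro j hj
      have h3 := h2 j (Finset.mem_univ j)
      rw [hpk j hj] at h3
      exact_mod_cast (mul_eq_zero.mp h3).resolve_right hc.ne'
    rcases D.eq_simpleRoot_of_support hmem hs with e | e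
    · exfalso
      rw [e] at hnonpos
      have := hnonpos i
      simp [simpleRoot] at this
    · exact ⟨k, e⟩
  have hw' : w' = w * (w⁻¹ * w') := by group
  set y := w⁻¹ * w'
  obtain ⟨k, hk⟩ := key y (fun h => hne (inv_mul_eq_one.mp h)) (hw' ▸ hp')
  have hyk : D.action (y * D.s k) (D.simpleRoot k) = D.simpleRoot i := by
    rw [action_mul_s_simpleRoot, hk, neg_neg]
  have hy1 : y * D.s k = 1 := by
    by_contra hy
    have hpy : p ∈ D.alcove (w * (y * D.s k)) := by
      refine D.mem_alcove_iff.mpr fun j => ?_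
      rw [← mul_assoc, ← hw', affineValue_action_mul_s]
      have : D.affineValue p (D.action w' (D.simpleRoot k)) = 0 := by
        rw [hw', action_mul, hk, map_neg, affineValue_neg, hpi, neg_zero]
      rw [this, mul_zero, sub_zero]
      exact D.mem_alcove_iff.mp hp' j
    obtain ⟨l, hl⟩ := key _ hy hpy
    rw [← hyk] at hl
    obtain rfl := D.eq_of_simpleRoot_eq_or_neg (Or.inr hl)
    exact D.affineRoots_ne_zero (D.action_simpleRoot_mem (y * D.s l) l) (self_eq_neg.mp hl)
  rw [hy1, action_one] at hyk
  rw [hw', ← D.simpleRoot_injective hyk, ← mul_one y, ← D.s_mul_s k, ← mul_assoc y, hy1, one_mul]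

/-! ### Alcove walks -/

theorem s_injective : Function.Injective D.s := by
  intro i j h
  refine D.simpleRoot_injective ?_
  have := D.root_eq_of_conj_s_eq (x := 1) (y := 1) (i := i) (j := j) (by rw [h])
    (by rw [action_one]; exact D.simpleRoot_nonneg i)
    (by rw [action_one]; exact D.simpleRoot_nonneg j)
  rwa [action_one, action_one] at this

theorem stepType_alcove (w : D.AffineWeylGroup) (i : I) :
    D.stepType (D.alcove w) (D.alcove (w * D.s i)) = i := by
  obtain ⟨v, h1, h2⟩ := Classical.epsilon_spec_aux ⟨D.zero⟩
    (fun j => ∃ v, D.alcove w = D.alcove v ∧ D.alcove (w * D.s i) = D.alcove (v * D.s j))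
    ⟨i, w, rfl, rfl⟩
  have h1 := D.alcove_injective h1
  subst h1
  exact (D.s_injective (mul_left_cancel (D.alcove_injective h2))).symm

theorem element_alcove (w : D.AffineWeylGroup) : D.element (D.alcove w) = w :=
  Function.leftInverse_invFun D.alcove_injective w

/-- For both signs of a crossing, the step from `w a_0` to `w s_i a_0` is indexed by `w α_i`. -/
theorem stepRoot_alcove (w : D.AffineWeylGroup) (i : I) :
    D.stepRoot (D.alcove w) (D.alcove (w * D.s i)) = D.action w (D.simpleRoot i) := by
  have hmem := D.action_simpleRoot_mem w i
  have hlen := D.length_mul_s w i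
  obtain ⟨hβ, ⟨F, hF, hF', hsub⟩, hpos, hneg⟩ := Classical.epsilon_spec (p := fun β =>
    β ∈ D.affineRoots ∧ (∃ F, D.IsPanel (D.alcove w) F ∧ D.IsPanel (D.alcove (w * D.s i)) F ∧
      F ⊆ D.hyperplane β) ∧
    (D.length (D.element (D.alcove w)) < D.length (D.element (D.alcove (w * D.s i))) →
      β ∈ D.positiveRoots) ∧
    (D.length (D.element (D.alcove (w * D.s i))) < D.length (D.element (D.alcove w)) →
      β ∈ D.negativeRoots)) ⟨D.action w (D.simpleRoot i), hmem,
    ⟨_, D.isPanel_left w i, D.isPanel_right w i, Set.inter_subset_right⟩, by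
      rw [element_alcove, element_alcove]
      exact fun h => ⟨hmem, D.action_simpleRoot_nonneg h⟩, by
      rw [element_alcove, element_alcove]
      exact fun h => ⟨hmem, fun h' =>
        D.not_nonneg_of_nonpos hmem (D.action_simpleRoot_nonpos h) h'.2⟩⟩
  change D.stepRoot (D.alcove w) (D.alcove (w * D.s i)) ∈ _ at hβ
  change F ⊆ D.hyperplane (D.stepRoot (D.alcove w) (D.alcove (w * D.s i))) at hsub
  change _ → D.stepRoot (D.alcove w) (D.alcove (w * D.s i)) ∈ _ at hpos
  change _ → D.stepRoot (D.alcove w) (D.alcove (w * D.s i)) ∈ _ at hneg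
  rw [element_alcove, element_alcove] at hpos hneg
  have hne : w ≠ w * D.s i := by
    intro h
    rw [← h] at hlen
    omega
  obtain ⟨j, hj, -, hspan⟩ := D.exists_eq_mul_s hne hF hF'
  obtain rfl := D.s_injective (mul_left_cancel hj)
  have hsub' := D.affineSpan_subset_hyperplane hsub
  rw [hspan] at hsub'
  rcases D.eq_or_neg_of_hyperplane_subset hmem hβ hsub' with h | h
  · exact h
  exfalso
  rw [h] at hpos hneg
  rcases hlen with hl | hl
  · exact D.not_nonneg_of_nonpos (D.neg_mem_affineRoots hmem)
      (neg_nonpos.mpr (D.action_simpleRoot_nonneg (by omega))) (hpos (by omega)).2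
  · exact (hneg (by omega)).2 ⟨D.neg_mem_affineRoots hmem,
      neg_nonneg.mpr (D.action_simpleRoot_nonpos (by omega))⟩

/-- The sequence of group elements of an alcove walk. -/
theorem AlcoveWalk.exists_elements {D : AffineCartanDatum I} (γ : D.AlcoveWalk) :
    ∃ u : Fin (γ.m + 1) → D.AffineWeylGroup, (∀ j, γ.a j = D.alcove (u j)) ∧ u 0 = 1 ∧
      (∀ j : Fin γ.m, u j.succ = u j.castSucc * D.s (γ.type j)) ∧
      ∀ j : Fin γ.m, γ.root j = D.action (u j.castSucc) (D.simpleRoot (γ.type j)) := by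
  choose u hu using fun j => D.isAlcove_iff.mp (γ.isAlcove j)
  have hstep : ∀ j : Fin γ.m, ∃ i, u j.succ = u j.castSucc * D.s i := by
    intro j
    obtain ⟨F, hF, hF'⟩ := γ.share_panel j
    have hne := γ.ne j
    rw [hu, hu] at hne
    rw [hu] at hF hF'
    obtain ⟨i, hi, -⟩ := D.exists_eq_mul_s (fun h => hne (by rw [h])) hF hF'
    exact ⟨i, hi⟩
  have htype : ∀ j : Fin γ.m, u j.succ = u j.castSucc * D.s (γ.type j) := by
    intro j
    obtain ⟨i, hi⟩ := hstep j
    rw [type, hu, hu, hi, stepType_alcove]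
  refine ⟨u, hu, D.alcove_injective ?_, htype, fun j => ?_⟩
  · rw [← hu, γ.start, alcove_one]
  · rw [root, hu, hu, htype, stepRoot_alcove]

/-- Every alcove is the end of an alcove walk. -/
theorem exists_alcoveWalk (w : D.AffineWeylGroup) : ∃ γ : D.AlcoveWalk, γ.IsTo w := by
  obtain ⟨ω, rfl⟩ := D.cs.wordProd_surjective w
  have hstep : ∀ j : Fin ω.length, D.cs.wordProd (ω.take (j + 1)) =
      D.cs.wordProd (ω.take j) * D.s ω[j] := by
    intro j
    rw [← List.take_concat_get' ω j j.2, CoxeterSystem.wordProd_append,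
      CoxeterSystem.wordProd_singleton]
    rfl
  refine ⟨⟨ω.length, fun j => D.alcove (D.cs.wordProd (ω.take j)),
    fun j => D.isAlcove_iff.mpr ⟨_, rfl⟩, ?_, fun j => ?_, fun j => ?_⟩, ?_⟩
  · simp [alcove_one]
  · intro h
    have h := D.alcove_injective h
    rw [Fin.val_castSucc, Fin.val_succ, hstep j] at h
    have := D.length_mul_s (D.cs.wordProd (ω.take j)) ω[j]
    rw [← h] at this
    omega
  · refine ⟨_, D.isPanel_left _ ω[j], ?_⟩
    rw [Fin.val_castSucc, Fin.val_succ, hstep j]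
    exact D.isPanel_right _ _
  · change D.alcove (D.cs.wordProd (ω.take (Fin.last ω.length))) = _
    simp

end AffineCartanDatum

theorem proposition1 {I : Type*} [Fintype I] [DecidableEq I] (D : AffineCartanDatum I)
    (w v : D.AffineWeylGroup) :
    (∀ γ γ' : D.AlcoveWalk, γ.IsTo w → γ'.IsTo w → γ.maskSum v = γ'.maskSum v) ∧
    ∃! ψ : MvPolynomial I ℤ, ∀ γ : D.AlcoveWalk, γ.IsTo w → γ.maskSum v = ψ := by
  have h : ∀ γ γ' : D.AlcoveWalk, γ.IsTo w → γ'.IsTo w → γ.maskSum v = γ'.maskSum v := by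
    intro γ γ' hγ hγ'
    obtain ⟨u, hu, h0, h1, h2⟩ := γ.exists_elements
    obtain ⟨u', hu', h0', h1', h2'⟩ := γ'.exists_elements
    have hend : u (Fin.last γ.m) = u' (Fin.last γ'.m) := by
      apply D.alcove_injective
      rw [← hu, ← hu']
      exact hγ.trans hγ'.symm
    rw [γ.maskSum_eq, γ'.maskSum_eq, D.maskElement_eq h0 h1 h2 h0' h1' h2' hend]
  refine ⟨h, ?_⟩
  obtain ⟨γ₀, hγ₀⟩ := D.exists_alcoveWalk w
  exact ⟨γ₀.maskSum v, fun γ hγ => h γ γ₀ hγ hγ₀, fun ψ hψ => (hψ γ₀ hγ₀).symm⟩
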